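/- Let $X$ be a dendrite with more than one point, that is, a nondegenerate locally connected metrizable continuum containing no subset homeomorphic to the circle. A point $x\in X$ is a *cutpoint* if $X\setminus\{x\}$ is not connected. For distinct $x,y\in X$ let $(x,y)$ denote the unique closed arc in $X$ joining $x$ and $y$, without its endpoints. Let $f:X\to X$ be continuous. A point is a *critical point* of $f$ if it has no neighborhood on which $f$ is one-to-one. Assume that * $f$ has no wandering continua: there is no nondegenerate continuum $K\subset X$ such that $f^m(K)\cap f^n(K)=\emptyset$ for all integers $m\ne n$, $m,n\ge 0$; * $f$ has no identity return: there are no nondegenerate continuum $K\subset X$ and integer $n>0$ with $f^n|_K=\mathrm{id}|_K$. Then the following hold. 1. $f$ has a critical point that is a cutpoint of $X$ and is not fixed by $f$. 2. If in addition $f$ is finite-to-one and has only finitely many critical points, then $f$ has a fixed cutpoint, and there is no closed arc $I\subset X$ (a subset homeomorphic to $[0,1]$) such that $f^n|_I$ is one-to-one for all $n\ge 0$. In particular, the set $P=\bigcup_{n\ge1}f^{-n}(C_f)$ of all preimages of the critical points (where $C_f$ is the set of critical points of $f$) is condense in $X$: for every nondegenerate continuum $K\subset X$ the set $P\cap K$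 is dense in $K$. 3. If $f$ has exactly one critical point $c$, then $f(c)\neq c$ and $f$ has a fixed cutpoint $a\in(c,f(c))$. -/

import Mathlib

namespace DendriteMap

open Set Topology Function

/-- A dendrite: a locally connected (metrizable) continuum that contains no subset homeomorphic
to the unit circle. One-point spaces are not excluded here. -/
structure IsDendrite (X : Type*) [TopologicalSpace X] : Prop where
  metrizable : TopologicalSpace.MetrizableSpace X
  compact : CompactSpace X
  connected : ConnectedSpace X
  locallyConnected : LocallyConnectedSpace X
  no_circle : ∀ S : Set X, IsEmpty (S ≃ₜ Circle)

variable {X : Type*} [TopologicalSpace X]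

/-- A nondegenerate subcontinuum: compact, connected, and not a point. -/
def IsNondegContinuum (K : Set X) : Prop :=
  IsCompact K ∧ IsConnected K ∧ K.Nontrivial

/-- `K` is wandering: its images `f^n(K)`, `n ≥ 0`, are pairwise disjoint. -/
def IsWandering (f : X → X) (K : Set X) : Prop :=
  ∀ m n : ℕ, m ≠ n → Disjoint (f^[m] '' K) (f^[n] '' K)

/-- `f` has no wandering (nondegenerate) continuum. -/
def NoWanderingContinua (f : X → X) : Prop :=
  ∀ K : Set X, IsNondegContinuum K → ¬ IsWandering f K

/-- `f` has an identity return: some positive iterate is the identity on some nondegenerate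
continuum. -/
def HasIdentityReturn (f : X → X) : Prop :=
  ∃ K : Set X, IsNondegContinuum K ∧ ∃ n : ℕ, 0 < n ∧ EqOn f^[n] id K

/-- A critical point: no neighbourhood of it is mapped one-to-one. -/
def IsCriticalPoint (f : X → X) (x : X) : Prop :=
  ∀ U ∈ 𝓝 x, ¬ InjOn f U

/-- A cutpoint of the (connected) space: its complement is not connected. -/
def IsCutpoint (x : X) : Prop :=
  ¬ IsPreconnected ({x}ᶜ : Set X)

/-- A closed arc (interval): a subset homeomorphic to `[0, 1]`. -/
def IsArc (I : Set X) : Prop :=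
  Nonempty (unitInterval ≃ₜ I)

/-- `I` is a closed arc with endpoints `x` and `y` (in particular `x ≠ y`). -/
def IsArcBetween (x y : X) (I : Set X) : Prop :=
  ∃ e : unitInterval ≃ₜ I, (e 0 : X) = x ∧ (e 1 : X) = y

/-- The open arc `(x, y)`. In a dendrite there is exactly one closed arc joining two distinct
points `x`, `y`, and `(x, y)` is that arc without its endpoints. -/
def openArc (x y : X) : Set X :=
  {z | z ≠ x ∧ z ≠ y ∧ ∃ I : Set X, IsArcBetween x y I ∧ z ∈ I}

/-- `A` is condense: dense in each nondegenerate subcontinuum. -/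
def IsCondense (A : Set X) : Prop :=
  ∀ K : Set X, IsNondegContinuum K → K ⊆ closure (A ∩ K)

/-- The set of all iterated preimages of critical points, i.e. the points `x` such that
`f^n(x)` is critical for some `n ≥ 1`. -/
def criticalPreimages (f : X → X) : Set X :=
  {x | ∃ n : ℕ, 1 ≤ n ∧ IsCriticalPoint f (f^[n] x)}

end DendriteMap

/-! In a dendrite two points span a unique arc `seg x y`. Each root p therefore gives a partial
order, x ≤ y when x lies on `seg p y`, in which chains have suprema. A map without critical points
in the interior of an arc is one-to-one on it, because a shortest fold would produce a circle.

Everything rests on `not_periodic_endpoint`: an arc on which all iterates are one-to-one has no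
periodic endpoint q. If some return to q preserves the germ of the arc, an iterate maps an arc at q
monotonically into itself. Then it is the identity there, or some orbit converges monotonically to a
fixed point and a fundamental domain of this attraction wanders. If no germ is preserved, image arcs
with the same base point meet only at it, and all but finitely many of them point away from the rest
of the finite orbit of q, so a subarc of an image wanders.

Part 1: if all critical cutpoints were fixed, f would be one-to-one on arcs without interior fixed
points. Two neighbouring fixed points would bound an invariant arc, and if there is only one fixed
point, all iterates are one-to-one on arcs issuing from it; both are impossible.

Part 2: by `exists_fixed_between`, an iterate with finitely many critical points has a fixed point
cutting any given invariant subcontinuum. If all iterates were one-to-one on I, two images of I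
would meet, and the images under the corresponding iterate would chain up to a connected invariant
set. A fixed point cutting its closure lies on an image of I, which is excluded. Condensity follows,
as a short arc missing all critical preimages would be such an I.

Part 3: take a maximal point a of `seg c (f c)` that f moves away from c. Were a not fixed, f would
map the arc from a to a fixed point beyond it one-to-one into itself. -/

namespace DendriteMap

open Set Topology Filter Function

/-! ### Compact locally connected metric spaces are locally path connected. -/

section PeanoPath

variable {X : Type*} [MetricSpace X]

/-- A `δ`-chain with `N` steps inside `C` from `x` to `y`. -/
def IsChainIn (C : Set X) (δ : ℝ) (x y : X) (N : ℕ) (c : ℕ → X) : Prop :=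
  c 0 = x ∧ (∀ i, N ≤ i → c i = y) ∧ (∀ i, dist (c i) (c (i + 1)) < δ) ∧ ∀ i, c i ∈ C

theorem IsChainIn.trans {C : Set X} {δ : ℝ} {x y z : X} {N M : ℕ} {c d : ℕ → X}
    (hc : IsChainIn C δ x y N c) (hd : IsChainIn C δ y z M d) :
    IsChainIn C δ x z (N + M) (fun i => if i < N then c i else d (i - N)) := by
  obtain ⟨c0, cN, cd, cC⟩ := hc
  obtain ⟨d0, dM, dd, dC⟩ := hd
  refine ⟨?_, ?_, ?_, ?_⟩
  · by_cases h : 0 < N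
    · simp [h, c0]
    · have : N = 0 := by omega
      subst this
      simp [d0, ← c0, cN 0 le_rfl]
  · intro i hi
    have : ¬ i < N := by omega
    simp only [this, if_false]
    exact dM _ (by omega)
  · intro i
    by_cases h : i + 1 < N
    · have h' : i < N := by omega
      simp only [h, h', if_true]
      exact cd i
    · by_cases h' : i < N
      · have e : i + 1 - N = 0 := by omega
        simp only [h, h', if_true, if_false, e, d0, ← cN (i + 1) (by omega)]
        exact cd i
      · have e : i + 1 - N = (i - N) + 1 := by omega
        simp only [h, h', if_false, e]
        exact dd _
  · intro i
    dsimp only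
    split_ifs
    · exact cC i
    · exact dC _

/-- Being joined by a δ-chain is an equivalence relation on C with relatively open classes. -/
theorem IsPreconnected.exists_isChainIn {C : Set X} (hC : IsPreconnected C) {δ : ℝ} (hδ : 0 < δ)
    {x y : X} (hx : x ∈ C) (hy : y ∈ C) : ∃ N c, IsChainIn C δ x y N c := by
  have step : ∀ u ∈ C, ∀ v ∈ C, dist u v < δ → ∃ N c, IsChainIn C δ u v N c := by
    intro u hu v hv h
    refine ⟨1, fun i => if i = 0 then u else v, by simp, ?_, ?_, ?_⟩
    · intro i hi
      have : i ≠ 0 := by omega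
      simp [this]
    · intro i
      by_cases hi : i = 0
      · simp [hi, h]
      · simp [hi, hδ]
    · intro i
      dsimp only
      split_ifs <;> assumption
  refine hC.induction₂' (fun a b => ∃ N c, IsChainIn C δ a b N c) ?_ ?_ hx hy
  · intro a ha
    filter_upwards [self_mem_nhdsWithin, mem_nhdsWithin_of_mem_nhds (Metric.ball_mem_nhds a hδ)]
      with b hb hb'
    refine ⟨step a ha b hb ?_, step b hb a ha hb'⟩
    rw [dist_comm]; exact hb'
  · rintro a b c _ _ _ ⟨N, p, hp⟩ ⟨M, q, hq⟩
    exact ⟨_, _, hp.trans hq⟩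

/-- δ comes from a Lebesgue number of a cover by connected open sets inside balls of radius ε/2. -/
theorem exists_uniform_connected [CompactSpace X] [LocallyConnectedSpace X] {ε : ℝ} (hε : 0 < ε) :
    ∃ δ > 0, δ ≤ ε ∧ ∀ x y : X, dist x y < δ →
      ∃ C : Set X, IsPreconnected C ∧ x ∈ C ∧ y ∈ C ∧ ∀ z ∈ C, dist z x < ε := by
  have h : ∀ z : X, ∃ V : Set X, IsOpen V ∧ z ∈ V ∧ IsPreconnected V ∧ V ⊆ Metric.ball z (ε / 2) := by
    intro z
    obtain ⟨V, hV, hVo, hz, hVc⟩ := locallyConnectedSpace_iff_subsets_isOpen_isConnected.1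
      ‹LocallyConnectedSpace X› z (Metric.ball z (ε / 2)) (Metric.ball_mem_nhds z (by positivity))
    exact ⟨V, hVo, hz, hVc.isPreconnected, hV⟩
  choose V hVo hzV hVc hV using h
  obtain ⟨δ, hδ, hL⟩ := lebesgue_number_lemma_of_metric (isCompact_univ (X := X)) hVo
    (fun z _ => mem_iUnion.2 ⟨z, hzV z⟩)
  refine ⟨min δ ε, lt_min hδ hε, min_le_right _ _, fun x y hxy => ?_⟩
  obtain ⟨z, hz⟩ := hL x (mem_univ x)
  have hx : x ∈ V z := hz (Metric.mem_ball_self hδ)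
  refine ⟨V z, hVc z, hx, hz ?_, fun w hw => ?_⟩
  · rw [Metric.mem_ball, dist_comm]; exact hxy.trans_le (min_le_left _ _)
  · have h1 := hV z hw
    have h2 := hV z hx
    rw [Metric.mem_ball] at h1 h2
    calc dist w x ≤ dist w z + dist x z := dist_triangle_right _ _ _
      _ < ε := by linarith

/-- A finite approximation `c 0, …, c M` of a path from `x` to `y` with steps shorter than `δ`. -/
def IsApprox (x y : X) (δ : ℝ) (c : ℕ → X) (M : ℕ) : Prop :=
  0 < M ∧ c 0 = x ∧ c M = y ∧ ∀ i < M, dist (c i) (c (i + 1)) < δ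

/-- Each step is replaced by a finer chain inside a small connected set. All these chains are padded
to one length N, so the new index k sits over the old index k / N and both approximations share the
same time scale. -/
theorem IsApprox.refine {x y : X} {δ δ' ε : ℝ} {c : ℕ → X} {M : ℕ} (h : IsApprox x y δ c M)
    (hδ' : 0 < δ') (hε : 0 < ε)
    (hC : ∀ x y : X, dist x y < δ →
      ∃ C : Set X, IsPreconnected C ∧ x ∈ C ∧ y ∈ C ∧ ∀ z ∈ C, dist z x < ε) :
    ∃ c' N, 0 < N ∧ IsApprox x y δ' c' (N * M) ∧ ∀ k, dist (c' k) (c (k / N)) < ε := by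
  obtain ⟨hM, c0, cM, cd⟩ := h
  have h : ∀ i, ∃ (N : ℕ) (p : ℕ → X), p 0 = c i ∧ (i < M → ∀ j, N ≤ j → p j = c (i + 1)) ∧
      (∀ j, dist (p j) (p (j + 1)) < δ') ∧ ∀ j, dist (p j) (c i) < ε := by
    intro i
    by_cases hi : i < M
    · obtain ⟨C, hC, h1, h2, h3⟩ := hC _ _ (cd i hi)
      obtain ⟨N, p, p0, pN, pd, pC⟩ := IsPreconnected.exists_isChainIn hC hδ' h1 h2
      exact ⟨N, p, p0, fun _ => pN, pd, fun j => h3 _ (pC j)⟩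
    · exact ⟨0, fun _ => c i, rfl, fun h => absurd h hi, by simpa using hδ', by simpa using hε⟩
  choose n p p0 pn pd pε using h
  set N := (Finset.range M).sup n + 1 with hN
  have hn : ∀ i < M, n i ≤ N := fun i hi =>
    (Finset.le_sup (f := n) (Finset.mem_range.2 hi)).trans (Nat.le_succ _)
  have hN0 : 0 < N := Nat.succ_pos _
  refine ⟨fun k => p (k / N) (k % N), N, hN0, ⟨Nat.mul_pos hN0 hM, ?_, ?_, ?_⟩, fun k => pε _ _⟩
  · simp [p0, c0]
  · simp [p0, cM]
  · intro k hk
    dsimp only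
    have hkM : k / N < M := Nat.div_lt_of_lt_mul hk
    by_cases hlast : k % N + 1 < N
    · have e1 : (k + 1) / N = k / N := by
        rw [Nat.succ_div_of_not_dvd]
        intro hd
        have := Nat.mod_eq_zero_of_dvd hd
        rw [Nat.add_mod, Nat.mod_eq_of_lt (show 1 < N by omega)] at this
        rw [Nat.mod_eq_of_lt hlast] at this
        omega
      have e2 : (k + 1) % N = k % N + 1 := by
        rw [Nat.add_mod, Nat.mod_eq_of_lt (show 1 < N by omega), Nat.mod_eq_of_lt hlast]
      rw [e1, e2]
      exact pd _ _
    · have hl : k % N + 1 = N := by have := Nat.mod_lt k hN0; omega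
      have hk1 : k + 1 = N * (k / N + 1) := by
        have := Nat.div_add_mod k N
        rw [Nat.mul_add]; omega
      have e1 : (k + 1) / N = k / N + 1 := by rw [hk1, Nat.mul_div_cancel_left _ hN0]
      have e2 : (k + 1) % N = 0 := by rw [hk1, Nat.mul_mod_right]
      rw [e1, e2, p0, ← pn _ hkM (k % N + 1) (by rw [hl]; exact hn _ hkM)]
      exact pd _ _

/-- Successive refinements, read as step functions of t, are uniformly Cauchy with geometric errors.
Their jumps tend to 0, so the limit is continuous. -/
theorem exists_short_path [CompactSpace X] [LocallyConnectedSpace X] {ε : ℝ} (hε : 0 < ε) :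
    ∃ δ > 0, ∀ x y : X, dist x y < δ →
      ∃ g : ℝ → X, ContinuousOn g (Icc 0 1) ∧ g 0 = x ∧ g 1 = y ∧
        ∀ t ∈ Icc (0 : ℝ) 1, dist (g t) x < 4 * ε := by
  have hpos : ∀ n : ℕ, 0 < ε / 2 / 2 ^ n := fun n => by positivity
  choose δ hδ hδε hδC using fun n => exists_uniform_connected (X := X) (hpos n)
  refine ⟨δ 0, hδ 0, fun x y hxy => ?_⟩
  let S (n : ℕ) := {p : (ℕ → X) × ℕ // IsApprox x y (δ n) p.1 p.2}
  let s0 : S 0 := ⟨(fun i => if i = 0 then x else y, 1), by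
    refine ⟨one_pos, by simp, by simp, fun i hi => ?_⟩
    have : i = 0 := by omega
    simpa [this] using hxy⟩
  have step : ∀ n (s : S n), ∃ s' : S (n + 1), ∃ N, 0 < N ∧ s'.1.2 = N * s.1.2 ∧
      ∀ k, dist (s'.1.1 k) (s.1.1 (k / N)) < ε / 2 / 2 ^ n := by
    rintro n ⟨⟨c, M⟩, h⟩
    obtain ⟨c', N, hN, h', hd⟩ := h.refine (hδ (n + 1)) (hpos n) (hδC n)
    exact ⟨⟨(c', N * M), h'⟩, N, hN, rfl, hd⟩
  choose nxt N hN hM hd using step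
  let s : ∀ n, S n := fun n => Nat.rec s0 nxt n
  have hs : ∀ n, s (n + 1) = nxt n (s n) := fun n => rfl
  let M : ℕ → ℕ := fun n => (s n).1.2
  let g : ℕ → ℝ → X := fun n t => (s n).1.1 ⌊t * M n⌋₊
  have hgd : ∀ t : ℝ, ∀ n, dist (g n t) (g (n + 1) t) ≤ ε / 2 / 2 ^ n := by
    intro t n
    -- At every time t the finer index lies in the block over the coarser index, so the refinement
    -- estimate applies pointwise.
    have h1 : (⌊t * M n⌋₊) = ⌊t * M (n + 1)⌋₊ / (N n (s n)) := by
      have hMn : M (n + 1) = N n (s n) * M n := by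
        change (s (n + 1)).1.2 = _
        rw [hs, hM]
      rw [← Nat.floor_div_natCast, hMn]
      congr 1
      have : (N n (s n) : ℝ) ≠ 0 := by exact_mod_cast (hN n (s n)).ne'
      push_cast
      field_simp
    change dist ((s n).1.1 ⌊t * M n⌋₊) ((s (n + 1)).1.1 ⌊t * M (n + 1)⌋₊) ≤ _
    rw [h1, dist_comm]
    exact (hd n (s n) _).le
  have hcau : ∀ t, ∃ l, Tendsto (fun n => g n t) atTop (𝓝 l) := fun t =>
    cauchySeq_tendsto_of_complete (cauchySeq_of_le_geometric_two (hgd t))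
  choose G hG using hcau
  have hGd : ∀ t n, dist (g n t) (G t) ≤ ε / 2 ^ n := fun t n =>
    dist_le_of_le_geometric_two_of_tendsto (hgd t) (hG t) n
  have hA : ∀ n, IsApprox x y (δ n) (s n).1.1 (M n) := fun n => (s n).2
  have hosc : ∀ n, ∀ a ∈ Icc (0 : ℝ) 1, ∀ b ∈ Icc (0 : ℝ) 1, a ≤ b → b - a < 1 / M n →
      dist (g n a) (g n b) ≤ δ n := by
    intro n a ha b hb hab hba
    have hMpos : (0 : ℝ) < M n := by exact_mod_cast (hA n).1
    have h1 : a * M n ≤ b * M n := by gcongr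
    have h2 : b * M n < a * M n + 1 := by
      rw [lt_div_iff₀ hMpos] at hba; linarith
    have h3 : ⌊a * M n⌋₊ ≤ ⌊b * M n⌋₊ := Nat.floor_le_floor h1
    have h4 : ⌊b * M n⌋₊ ≤ ⌊a * M n⌋₊ + 1 := by
      rw [← Nat.floor_add_one (by have := ha.1; positivity)]
      exact Nat.floor_le_floor h2.le
    have h5 : ⌊b * M n⌋₊ ≤ M n := by
      have : b * M n ≤ (M n : ℝ) := by nlinarith [hb.2]
      calc _ ≤ ⌊(M n : ℝ)⌋₊ := Nat.floor_le_floor this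
        _ = M n := Nat.floor_natCast _
    change dist ((s n).1.1 ⌊a * M n⌋₊) ((s n).1.1 ⌊b * M n⌋₊) ≤ _
    rcases Nat.eq_or_lt_of_le h3 with h | h
    · rw [h, dist_self]; exact (hδ n).le
    · have : ⌊b * M n⌋₊ = ⌊a * M n⌋₊ + 1 := by omega
      rw [this]
      exact ((hA n).2.2.2 _ (by omega)).le
  have hosc' : ∀ n, ∀ a ∈ Icc (0 : ℝ) 1, ∀ b ∈ Icc (0 : ℝ) 1, |b - a| < 1 / M n →
      dist (g n a) (g n b) ≤ δ n := by
    intro n a ha b hb hab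
    rcases le_total a b with h | h
    · exact hosc n a ha b hb h (by rwa [abs_of_nonneg (by linarith)] at hab)
    · rw [dist_comm]
      exact hosc n b hb a ha h (by rw [abs_sub_comm, abs_of_nonneg (by linarith)] at hab; exact hab)
  refine ⟨G, ?_, ?_, ?_, ?_⟩
  · rw [Metric.continuousOn_iff]
    intro b hb η hη
    obtain ⟨n, hn⟩ := exists_pow_lt_of_lt_one (show 0 < η / (3 * ε) by positivity)
      (show (1 / 2 : ℝ) < 1 by norm_num)
    have hn' : ε / 2 ^ n < η / 3 := by
      rw [lt_div_iff₀ (by positivity), one_div, inv_pow] at hn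
      calc ε / 2 ^ n = ((2 ^ n)⁻¹ * (3 * ε)) / 3 := by field_simp
        _ < η / 3 := by linarith
    have hMpos : (0 : ℝ) < M n := by exact_mod_cast (hA n).1
    refine ⟨1 / M n, by positivity, fun a ha hab => ?_⟩
    rw [Real.dist_eq] at hab
    have h1 := hosc' n b hb a ha hab
    have h2 := hδε n
    have h3 : ε / 2 / 2 ^ n ≤ ε / 2 ^ n := by
      have : (0:ℝ) < 2 ^ n := by positivity
      gcongr; linarith
    calc dist (G a) (G b) ≤ dist (G a) (g n a) + dist (g n a) (g n b) + dist (g n b) (G b) :=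
          dist_triangle4 _ _ _ _
      _ ≤ ε / 2 ^ n + δ n + ε / 2 ^ n := by
          have := hGd a n
          have := hGd b n
          rw [dist_comm (G a), dist_comm (g n a) (g n b)]
          linarith
      _ < η := by linarith
  · refine tendsto_nhds_unique (hG 0) ?_
    have : ∀ n, g n 0 = x := fun n => by
      change (s n).1.1 ⌊0 * (M n : ℝ)⌋₊ = x
      rw [zero_mul, Nat.floor_zero, (hA n).2.1]
    simp only [this]
    exact tendsto_const_nhds
  · refine tendsto_nhds_unique (hG 1) ?_
    have : ∀ n, g n 1 = y := fun n => by
      change (s n).1.1 ⌊1 * (M n : ℝ)⌋₊ = y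
      rw [one_mul, Nat.floor_natCast, (hA n).2.2.1]
    simp only [this]
    exact tendsto_const_nhds
  · intro t ht
    have h1 := hGd t 0
    have h3 : dist (g 0 t) x ≤ ε := by
      have hcases : ∀ i, dist ((s 0).1.1 i) x ≤ ε := by
        intro i
        change dist (if i = 0 then x else y) x ≤ ε
        split_ifs
        · simpa using hε.le
        · have := hδε 0
          rw [dist_comm]
          simp only [pow_zero, div_one] at this
          linarith
      exact hcases _
    calc dist (G t) x ≤ dist (g 0 t) (G t) + dist (g 0 t) x := by
          rw [dist_comm (g 0 t) (G t)]; exact dist_triangle _ _ _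
      _ < 4 * ε := by simp at h1; linarith

theorem locallyPathConnectedSpace_of_compact_locallyConnected [CompactSpace X]
    [LocallyConnectedSpace X] : LocallyPathConnectedSpace X := by
  rw [locallyPathConnectedSpace_iff_pathComponentIn_mem_nhds]
  intro x U hU hxU
  obtain ⟨r, hr, hrU⟩ := Metric.isOpen_iff.1 hU x hxU
  obtain ⟨δ, hδ, h⟩ := exists_short_path (X := X) (show 0 < r / 4 by positivity)
  filter_upwards [Metric.ball_mem_nhds x hδ] with y hy
  rw [Metric.mem_ball, dist_comm] at hy
  obtain ⟨g, hg, g0, g1, hgx⟩ := h x y hy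
  refine JoinedIn.ofLine hg g0 g1 ?_
  rintro _ ⟨t, ht, rfl⟩
  refine hrU ?_
  have := hgx t ht
  rw [Metric.mem_ball]
  linarith

end PeanoPath

/-- `α` restricted to `[a, b]` parametrizes an arc. -/
def IsArcParam {X : Type*} [TopologicalSpace X] (α : ℝ → X) (a b : ℝ) : Prop :=
  a < b ∧ ContinuousOn α (Icc a b) ∧ InjOn α (Icc a b)

/-! ### From paths to arcs. -/

section PathToArc

variable {X : Type*} [MetricSpace X]

/-- Closed subsets of `[0, 1]` containing the endpoints over whose gaps `γ` makes a loop. -/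
def shortcutSets (γ : ℝ → X) : Set (Set ℝ) :=
  {K | IsClosed K ∧ K ⊆ Icc 0 1 ∧ 0 ∈ K ∧ 1 ∈ K ∧
    ∀ s ∈ K, ∀ t ∈ K, s < t → (∀ u ∈ K, u ≤ s ∨ t ≤ u) → γ s = γ t}

/-- If γ took different values at the two ends of a gap (s, t) of the intersection, compactness
would give a member of the chain missing [s + η, t - η]. That member has a gap with ends near s and
t, where γ still differs. -/
theorem sInter_mem_shortcutSets {γ : ℝ → X} (hγ : Continuous γ) {c : Set (Set ℝ)}
    (hc : c ⊆ shortcutSets γ) (hch : IsChain (· ⊆ ·) c) (hne : c.Nonempty) :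
    ⋂₀ c ∈ shortcutSets γ := by
  obtain ⟨K₀, hK₀⟩ := hne
  refine ⟨isClosed_sInter fun K hK => (hc hK).1, (sInter_subset_of_mem hK₀).trans (hc hK₀).2.1,
    fun K hK => (hc hK).2.2.1, fun K hK => (hc hK).2.2.2.1, ?_⟩
  intro s hs t ht hst hgap
  by_contra hne
  have hev : ∀ᶠ p : ℝ × ℝ in 𝓝 (s, t), γ p.1 ≠ γ p.2 :=
    (((hγ.comp continuous_fst).continuousAt).ne_iff_eventually_ne
      ((hγ.comp continuous_snd).continuousAt)).1 hne
  obtain ⟨ε, hε, hball⟩ := Metric.eventually_nhds_iff.1 hev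
  set η := min (ε / 2) ((t - s) / 3) with hη
  have hη0 : 0 < η := lt_min (by positivity) (by linarith)
  have hη1 : η ≤ ε / 2 := min_le_left _ _
  have hη2 : η ≤ (t - s) / 3 := min_le_right _ _
  have hex : ∃ K ∈ c, K ∩ Icc (s + η) (t - η) = ∅ := by
    by_contra! hall
    have : Nonempty c := ⟨⟨K₀, hK₀⟩⟩
    have := IsCompact.nonempty_iInter_of_directed_nonempty_isCompact_isClosed
      (fun K : c => (K : Set ℝ) ∩ Icc (s + η) (t - η)) ?_ (fun K => hall K K.2)
      (fun K => isCompact_Icc.inter_left (hc K.2).1) (fun K => (hc K.2).1.inter isClosed_Icc)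
    · obtain ⟨u, hu⟩ := this
      rw [mem_iInter] at hu
      have hu1 : u ∈ ⋂₀ c := fun K hK => (hu ⟨K, hK⟩).1
      have hu2 := (hu ⟨K₀, hK₀⟩).2
      rcases hgap u hu1 with h | h
      · linarith [hu2.1]
      · linarith [hu2.2]
    · intro A B
      rcases hch.total A.2 B.2 with h | h
      · exact ⟨A, Subset.rfl, inter_subset_inter_left _ h⟩
      · exact ⟨B, inter_subset_inter_left _ h, Subset.rfl⟩
  obtain ⟨K, hK, hKe⟩ := hex
  have hKc := hc hK
  have hK' : ∀ u ∈ K, u ≤ s + η → u < s + η := by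
    intro u hu h
    refine lt_of_le_of_ne h ?_
    rintro rfl
    have : s + η ∈ K ∩ Icc (s + η) (t - η) := ⟨hu, le_rfl, by linarith⟩
    rw [hKe] at this
    exact this
  obtain ⟨p, hp, hpm⟩ := (isCompact_Icc.inter_left hKc.1 : IsCompact (K ∩ Icc s (s + η))).exists_isGreatest
    ⟨s, hs K hK, le_rfl, by linarith⟩
  obtain ⟨q, hq, hqm⟩ := (isCompact_Icc.inter_left hKc.1 : IsCompact (K ∩ Icc (t - η) t)).exists_isLeast
    ⟨t, ht K hK, by linarith, le_rfl⟩
  refine @hball (p, q) ?_ (hKc.2.2.2.2 p hp.1 q hq.1 (by linarith [hp.2.2, hq.2.1]) ?_)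
  · rw [Prod.dist_eq, max_lt_iff, Real.dist_eq, Real.dist_eq, abs_lt, abs_lt]
    dsimp only
    refine ⟨⟨?_, ?_⟩, ?_, ?_⟩ <;> linarith [hp.2.1, hp.2.2, hq.2.1, hq.2.2]
  · intro u hu
    by_contra! h
    have h1 : s + η < u := by
      by_contra! h1
      have := hpm ⟨hu, by linarith [hp.2.1], h1⟩
      linarith
    have h2 : u < t - η := by
      by_contra! h2
      have := hqm ⟨hu, h2, by linarith [hq.2.2]⟩
      linarith
    have : u ∈ K ∩ Icc (s + η) (t - η) := ⟨hu, h1.le, h2.le⟩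
    rw [hKe] at this
    exact this

/-- In a minimal K, equal values at s < t would allow K ∩ (s, t) to be deleted, so that set is
already empty. -/
theorem exists_minimal_shortcutSet {γ : ℝ → X} (hγ : Continuous γ) :
    ∃ K ∈ shortcutSets γ, ∀ s ∈ K, ∀ t ∈ K, s < t → γ s = γ t → ∀ u ∈ K, u ≤ s ∨ t ≤ u := by
  have h1 : Icc (0 : ℝ) 1 ∈ shortcutSets γ := by
    refine ⟨isClosed_Icc, Subset.rfl, by simp, by simp, fun s hs t ht hst h => ?_⟩
    rcases h ((s + t) / 2) ⟨by linarith [hs.1, ht.1], by linarith [hs.2, ht.2]⟩ with h | h <;> linarith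
  obtain ⟨K, -, hK⟩ := zorn_superset_nonempty (shortcutSets γ)
    (fun c hc hch hne => ⟨⋂₀ c, sInter_mem_shortcutSets hγ hc hch hne,
      fun s hs => sInter_subset_of_mem hs⟩) _ h1
  refine ⟨K, hK.prop, fun s hs t ht hst hγst => ?_⟩
  obtain ⟨hcl, hsub, h0, h1, hgap⟩ := hK.prop
  have hs01 := hsub hs
  have ht01 := hsub ht
  have hmem : K \ Ioo s t ∈ shortcutSets γ := by
    refine ⟨hcl.sdiff isOpen_Ioo, sdiff_subset.trans hsub, ⟨h0, fun h => ?_⟩, ⟨h1, fun h => ?_⟩, ?_⟩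
    · linarith [h.1, hs01.1]
    · linarith [h.2, ht01.2]
    · rintro p ⟨hp, hp'⟩ q ⟨hq, hq'⟩ hpq hpqgap
      by_cases hg : ∀ u ∈ K, u ≤ p ∨ q ≤ u
      · exact hgap p hp q hq hpq hg
      · push Not at hg
        obtain ⟨u, hu, hpu, huq⟩ := hg
        have hu' : u ∈ Ioo s t := by
          by_contra hu'
          rcases hpqgap u ⟨hu, hu'⟩ with h | h <;> linarith
        have hps : p ≤ s := by
          by_contra! h
          exact hp' ⟨h, hpu.trans hu'.2⟩
        have hqt : t ≤ q := by
          by_contra! h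
          exact hq' ⟨hu'.1.trans huq, h⟩
        have e1 : s = p := by
          rcases hpqgap s ⟨hs, fun h => lt_irrefl _ h.1⟩ with h | h
          · exact le_antisymm h hps
          · linarith
        have e2 : t = q := by
          rcases hpqgap t ⟨ht, fun h => lt_irrefl _ h.2⟩ with h | h
          · linarith
          · exact le_antisymm hqt h
        rw [← e1, ← e2, hγst]
  intro u hu
  by_contra! h
  exact (hK.le_of_le hmem sdiff_subset hu).2 h

/-- Every path can be replaced by one with connected fibres. -/
theorem exists_monotone_path {γ : ℝ → X} (hγ : Continuous γ) :
    ∃ Γ : ℝ → X, Continuous Γ ∧ Γ 0 = γ 0 ∧ Γ 1 = γ 1 ∧ (∀ t, Γ t ∈ γ '' Icc 0 1) ∧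
      ∀ s t r, s ≤ r → r ≤ t → Γ s = Γ t → Γ r = Γ s := by
  obtain ⟨K, ⟨hcl, hsub, h0, h1, hgap⟩, hmin⟩ := exists_minimal_shortcutSet hγ
  have hcomp : IsCompact K := isCompact_Icc.of_isClosed_subset hcl hsub
  let p : ℝ → ℝ := fun t => max 0 (min 1 t)
  have hp0 : ∀ t, 0 ≤ p t := fun t => le_max_left _ _
  have hp1 : ∀ t, p t ≤ 1 := fun t => max_le zero_le_one (min_le_left _ _)
  have hpm : Monotone p := fun s t h => max_le_max le_rfl (min_le_min le_rfl h)
  -- The new path freezes γ on each gap of K: κ t is the last point of K before the clamped time p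
  -- t.
  have hκ : ∀ t, ∃ k, IsGreatest (K ∩ Iic (p t)) k := fun t =>
    (hcomp.inter_right isClosed_Iic).exists_isGreatest ⟨0, h0, hp0 t⟩
  choose κ hκ using hκ
  have hκm : Monotone κ := fun s t h => (hκ t).2 ⟨(hκ s).1.1, (hκ s).1.2.trans (hpm h)⟩
  -- Although κ jumps, γ ∘ κ inherits the modulus of continuity of γ, since γ agrees at the two ends
  -- of a gap.
  have key : ∀ s t, s ≤ t → γ (κ s) = γ (κ t) ∨ ∃ s' t', p s ≤ s' ∧ s' ≤ t' ∧ t' ≤ p t ∧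
      γ (κ s) = γ s' ∧ γ (κ t) = γ t' := by
    intro s t hst
    by_cases h : κ t ≤ p s
    · left
      rw [le_antisymm (hκm hst) ((hκ s).2 ⟨(hκ t).1.1, h⟩)]
    · push Not at h
      right
      obtain ⟨s', hs', hs'm⟩ := (hcomp.inter_right (isClosed_Ici (a := p s))).exists_isLeast
        ⟨κ t, (hκ t).1.1, h.le⟩
      refine ⟨s', κ t, hs'.2, hs'm ⟨(hκ t).1.1, h.le⟩, (hκ t).1.2, ?_, rfl⟩
      rcases eq_or_lt_of_le (show κ s ≤ s' from (hκ s).1.2.trans hs'.2) with e | e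
      · rw [e]
      · refine hgap _ (hκ s).1.1 _ hs'.1 e fun u hu => ?_
        rcases le_total u (p s) with h | h
        · exact Or.inl ((hκ s).2 ⟨hu, h⟩)
        · exact Or.inr (hs'm ⟨hu, h⟩)
  refine ⟨fun t => γ (κ t), ?_, ?_, ?_, fun t => ⟨κ t, hsub (hκ t).1.1, rfl⟩, ?_⟩
  · have huc := isCompact_Icc.uniformContinuousOn_of_continuous (s := Icc (0 : ℝ) 1) hγ.continuousOn
    rw [Metric.uniformContinuousOn_iff] at huc
    rw [Metric.continuous_iff]
    have hpd : ∀ s t, s ≤ t → p t - p s ≤ t - s := by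
      intro s t h
      simp only [p]
      rcases max_cases 0 (min 1 t) with ⟨e, h1⟩ | ⟨e, h1⟩ <;>
      rcases max_cases 0 (min 1 s) with ⟨e', h1'⟩ | ⟨e', h1'⟩ <;>
      rcases min_cases 1 t with ⟨e2, h2⟩ | ⟨e2, h2⟩ <;>
      rcases min_cases 1 s with ⟨e2', h2'⟩ | ⟨e2', h2'⟩ <;> linarith
    intro b ε hε
    obtain ⟨δ, hδ, h⟩ := huc ε hε
    have main : ∀ s t, s ≤ t → t - s < δ → dist (γ (κ s)) (γ (κ t)) < ε := by
      intro s t hst hd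
      rcases key s t hst with e | ⟨s', t', h1, h2, h3, e1, e2⟩
      · rw [e, dist_self]; exact hε
      · rw [e1, e2]
        refine h s' ⟨(hp0 s).trans h1, h2.trans (h3.trans (hp1 t))⟩ t'
          ⟨(hp0 s).trans (h1.trans h2), h3.trans (hp1 t)⟩ ?_
        rw [Real.dist_eq, abs_sub_comm, abs_of_nonneg (by linarith)]
        linarith [hpd s t hst]
    refine ⟨δ, hδ, fun a ha => ?_⟩
    rw [Real.dist_eq, abs_lt] at ha
    rcases le_total a b with h | h
    · exact main a b h (by linarith)
    · rw [dist_comm]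
      exact main b a h (by linarith)
  · have : κ 0 = 0 := by
      refine le_antisymm ?_ (hsub (hκ 0).1.1).1
      have := (hκ 0).1.2
      simpa [p] using this
    simp only [this]
  · have : κ 1 = 1 := by
      refine le_antisymm (hsub (hκ 1).1.1).2 ((hκ 1).2 ⟨h1, ?_⟩)
      simp [p]
    simp only [this]
  · intro s t r hsr hrt h
    dsimp only at h ⊢
    rcases eq_or_lt_of_le (hκm (hsr.trans hrt)) with e | e
    · rw [le_antisymm ((hκm hrt).trans e.ge) (hκm hsr)]
    · rcases hmin _ (hκ s).1.1 _ (hκ t).1.1 e h _ (hκ r).1.1 with h' | h'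
      · rw [le_antisymm h' (hκm hsr)]
      · rw [le_antisymm (hκm hrt) h', h]

/-- A path with connected fibres factors through a real-valued function with the same fibres. -/
theorem exists_real_factor [SecondCountableTopology X] {Γ : ℝ → X} (hΓ : Continuous Γ)
    (hfib : ∀ s t r, s ≤ r → r ≤ t → Γ s = Γ t → Γ r = Γ s) :
    ∃ φ : ℝ → ℝ, Continuous φ ∧ ∀ s ∈ Icc (0 : ℝ) 1, ∀ t ∈ Icc (0 : ℝ) 1, s ≤ t →
      (Γ s = Γ t → φ s = φ t) ∧ (Γ s ≠ Γ t → φ s < φ t) := by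
  obtain ⟨b, hbc, -, hb⟩ := TopologicalSpace.exists_countable_basis X
  have hbne : b.Nonempty := by
    obtain ⟨V, hV, -⟩ := hb.exists_subset_of_mem_open (mem_univ (Γ 0)) isOpen_univ
    exact ⟨V, hV⟩
  obtain ⟨V, rfl⟩ := hbc.exists_eq_range hbne
  let u : ℕ → X → ℝ := fun n z => min 1 (Metric.infDist z (V n)ᶜ)
  have hu : ∀ n, Continuous (u n) := fun n => continuous_const.min (Metric.continuous_infDist_pt _)
  have hu0 : ∀ n z, 0 ≤ u n z := fun n z => le_min zero_le_one Metric.infDist_nonneg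
  have hu1 : ∀ n z, u n z ≤ 1 := fun n z => min_le_left _ _
  -- This is the running maximum of u n along Γ up to time t, rescaled to a fixed interval so that
  -- continuity is immediate. If Γ reaches a new point, some basic set around it misses the past,
  -- and its running maximum leaves 0.
  let w : ℕ → ℝ → ℝ := fun n t => sSup ((fun r => u n (Γ (t * r))) '' Icc 0 1)
  have hwc : ∀ n, Continuous (w n) := by
    intro n
    refine isCompact_Icc.continuous_sSup ?_
    exact (hu n).comp (hΓ.comp (continuous_fst.mul continuous_snd))
  have hbdd : ∀ n (A : Set ℝ) (h : ℝ → X), BddAbove ((fun r => u n (h r)) '' A) := by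
    intro n A h
    refine ⟨1, ?_⟩
    rintro _ ⟨r, -, rfl⟩
    exact hu1 _ _
  have hw : ∀ n t, 0 ≤ t → w n t = sSup ((fun r => u n (Γ r)) '' Icc 0 t) := by
    intro n t ht
    have : Icc 0 t = (fun r => t * r) '' Icc 0 1 := by
      rw [image_mul_left_Icc ht zero_le_one]; simp
    rw [this, image_image]
  have hw0 : ∀ n t, 0 ≤ w n t := by
    intro n t
    refine Real.sSup_nonneg ?_
    rintro _ ⟨r, -, rfl⟩
    exact hu0 _ _
  have hw1 : ∀ n t, w n t ≤ 1 := by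
    intro n t
    refine Real.sSup_le ?_ zero_le_one
    rintro _ ⟨r, -, rfl⟩
    exact hu1 _ _
  have hsum : Summable (fun n : ℕ => ((1 : ℝ) / 2) ^ n) := summable_geometric_two
  have hle : ∀ n t, ‖(1 / 2 : ℝ) ^ n * w n t‖ ≤ (1 / 2) ^ n := by
    intro n t
    rw [Real.norm_of_nonneg (mul_nonneg (by positivity) (hw0 n t))]
    exact mul_le_of_le_one_right (by positivity) (hw1 n t)
  have hS : ∀ t, Summable (fun n => (1 / 2 : ℝ) ^ n * w n t) := fun t =>
    Summable.of_norm_bounded hsum (fun n => hle n t)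
  have hmono : ∀ n s t, 0 ≤ s → s ≤ t → w n s ≤ w n t := by
    intro n s t hs hst
    rw [hw n s hs, hw n t (hs.trans hst)]
    exact csSup_le_csSup (hbdd n _ _) ((nonempty_Icc.2 hs).image _)
      (image_mono (Icc_subset_Icc_right hst))
  refine ⟨fun t => ∑' n, (1 / 2 : ℝ) ^ n * w n t,
    continuous_tsum (fun n => continuous_const.mul (hwc n)) hsum hle, ?_⟩
  intro s hs t ht hst
  constructor
  · intro h
    have : ∀ n, w n s = w n t := by
      intro n
      rw [hw n s hs.1, hw n t ht.1]
      congr 1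
      refine (image_mono (Icc_subset_Icc_right hst)).antisymm ?_
      rintro _ ⟨r, hr, rfl⟩
      rcases le_total r s with h' | h'
      · exact ⟨r, ⟨hr.1, h'⟩, rfl⟩
      · refine ⟨s, ⟨hs.1, le_rfl⟩, ?_⟩
        dsimp only
        rw [hfib s t r h' hr.2 h]
    simp only [this]
  · intro h
    have hnot : Γ t ∉ Γ '' Icc 0 s := by
      rintro ⟨r, hr, e⟩
      have := hfib r t s hr.2 hst e
      exact h (this.trans e)
    obtain ⟨_, ⟨n, rfl⟩, htV, hVs⟩ := hb.exists_subset_of_mem_open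
      (show Γ t ∈ (Γ '' Icc 0 s)ᶜ from hnot)
      (isCompact_Icc.image hΓ).isClosed.isOpen_compl
    refine Summable.tsum_lt_tsum (i := n) (fun m => ?_) ?_ (hS s) (hS t)
    · exact mul_le_mul_of_nonneg_left (hmono m s t hs.1 hst) (by positivity)
    · refine mul_lt_mul_of_pos_left ?_ (by positivity)
      have hVc : ∀ r ∈ Icc 0 s, Γ r ∈ (V n)ᶜ := fun r hr hrV => hVs hrV ⟨r, hr, rfl⟩
      have e0 : w n s = 0 := by
        refine le_antisymm ?_ (hw0 n s)
        rw [hw n s hs.1]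
        refine Real.sSup_le ?_ le_rfl
        rintro _ ⟨r, hr, rfl⟩
        refine (min_le_right _ _).trans ?_
        rw [Metric.infDist_zero_of_mem (hVc r hr)]
      have hpos : 0 < u n (Γ t) := by
        refine lt_min one_pos ?_
        refine ((hb.isOpen ⟨n, rfl⟩).isClosed_compl.notMem_iff_infDist_pos
          ⟨Γ s, hVc s ⟨hs.1, le_rfl⟩⟩).1 ?_
        simpa using htV
      rw [e0, hw n t ht.1]
      exact hpos.trans_le (le_csSup (hbdd n _ _) ⟨t, ⟨ht.1, le_rfl⟩, rfl⟩)

/-- The arc is Γ ∘ φ⁻¹; it is continuous because φ sends compact sets to closed sets. -/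
theorem exists_arc_of_path [SecondCountableTopology X] {γ : ℝ → X} (hγ : Continuous γ)
    (hne : γ 0 ≠ γ 1) :
    ∃ (α : ℝ → X) (a b : ℝ), IsArcParam α a b ∧ α a = γ 0 ∧ α b = γ 1 ∧
      α '' Icc a b ⊆ γ '' Icc 0 1 := by
  obtain ⟨Γ, hΓ, e0, e1, him, hfib⟩ := exists_monotone_path hγ
  obtain ⟨φ, hφ, hφΓ⟩ := exists_real_factor hΓ hfib
  have h0 : (0 : ℝ) ∈ Icc (0 : ℝ) 1 := by simp
  have h1 : (1 : ℝ) ∈ Icc (0 : ℝ) 1 := by simp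
  have hiff : ∀ s ∈ Icc (0 : ℝ) 1, ∀ t ∈ Icc (0 : ℝ) 1, φ s = φ t ↔ Γ s = Γ t := by
    have : ∀ s ∈ Icc (0 : ℝ) 1, ∀ t ∈ Icc (0 : ℝ) 1, s ≤ t → (φ s = φ t ↔ Γ s = Γ t) := by
      intro s hs t ht hst
      refine ⟨fun h => ?_, (hφΓ s hs t ht hst).1⟩
      by_contra hne
      exact ((hφΓ s hs t ht hst).2 hne).ne h
    intro s hs t ht
    rcases le_total s t with h | h
    · exact this s hs t ht h
    · rw [eq_comm, this t ht s hs h, eq_comm]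
  have hsurj : ∀ r, ∃ t, r ∈ Icc (φ 0) (φ 1) → t ∈ Icc (0 : ℝ) 1 ∧ φ t = r := by
    intro r
    by_cases hr : r ∈ Icc (φ 0) (φ 1)
    · obtain ⟨t, ht, e⟩ := intermediate_value_Icc zero_le_one hφ.continuousOn hr
      exact ⟨t, fun _ => ⟨ht, e⟩⟩
    · exact ⟨0, fun h => absurd h hr⟩
  choose τ hτ using hsurj
  have hmem : ∀ t ∈ Icc (0 : ℝ) 1, φ t ∈ Icc (φ 0) (φ 1) := by
    have hmono : ∀ s ∈ Icc (0 : ℝ) 1, ∀ t ∈ Icc (0 : ℝ) 1, s ≤ t → φ s ≤ φ t := by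
      intro s hs t ht hst
      by_cases h : Γ s = Γ t
      · exact ((hφΓ s hs t ht hst).1 h).le
      · exact ((hφΓ s hs t ht hst).2 h).le
    exact fun t ht => ⟨hmono 0 h0 t ht ht.1, hmono t ht 1 h1 ht.2⟩
  have hcomp : ∀ t ∈ Icc (0 : ℝ) 1, Γ (τ (φ t)) = Γ t := fun t ht =>
    (hiff _ (hτ _ (hmem t ht)).1 t ht).1 (hτ _ (hmem t ht)).2
  refine ⟨fun r => Γ (τ r), φ 0, φ 1, ⟨?_, ?_, ?_⟩, ?_, ?_, ?_⟩
  · exact (hφΓ 0 h0 1 h1 zero_le_one).2 (by rwa [e0, e1])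
  · rw [continuousOn_iff_isClosed]
    intro C hC
    refine ⟨φ '' (Icc 0 1 ∩ Γ ⁻¹' C),
      ((isCompact_Icc.inter_right (hC.preimage hΓ)).image hφ).isClosed, ?_⟩
    ext r
    constructor
    · rintro ⟨hr, hrI⟩
      exact ⟨⟨τ r, ⟨(hτ r hrI).1, hr⟩, (hτ r hrI).2⟩, hrI⟩
    · rintro ⟨⟨t, ⟨ht, htC⟩, rfl⟩, hrI⟩
      refine ⟨?_, hrI⟩
      change Γ (τ (φ t)) ∈ C
      rw [hcomp t ht]
      exact htC
  · intro r hr r' hr' h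
    have := (hiff _ (hτ r hr).1 _ (hτ r' hr').1).2 h
    rwa [(hτ r hr).2, (hτ r' hr').2] at this
  · rw [← e0]; exact hcomp 0 h0
  · rw [← e1]; exact hcomp 1 h1
  · rintro _ ⟨r, -, rfl⟩
    exact him _

end PathToArc

/-! ### Existence and uniqueness of arcs in a dendrite. -/

section Arcs

variable {X : Type*} [TopologicalSpace X]

/-- A loop that is injective up to its endpoints is a circle. -/
theorem IsDendrite.not_loop (hX : IsDendrite X) {α : ℝ → X} {a b : ℝ} (hab : a < b)
    (hα : ContinuousOn α (Icc a b)) (hinj : InjOn α (Ico a b)) : α a ≠ α b := by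
  intro h
  have := hX.metrizable
  obtain ⟨p, rfl⟩ : ∃ p, b = a + p := ⟨b - a, by ring⟩
  have hp : Fact (0 < p) := ⟨by linarith⟩
  have hc : Continuous (AddCircle.liftIco p a α) := AddCircle.liftIco_continuous h hα
  have hi : Injective (AddCircle.liftIco p a α) := by
    intro x y hxy
    obtain ⟨⟨x, hx⟩, rfl⟩ := (AddCircle.equivIco p a).symm.surjective x
    obtain ⟨⟨y, hy⟩, rfl⟩ := (AddCircle.equivIco p a).symm.surjective y
    change AddCircle.liftIco p a α (x : AddCircle p) = AddCircle.liftIco p a α (y : AddCircle p) at hxy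
    change ((x : AddCircle p)) = (y : AddCircle p)
    rw [AddCircle.liftIco_coe_apply hx, AddCircle.liftIco_coe_apply hy] at hxy
    rw [hinj hx hy hxy]
  have he := (hc.isClosedEmbedding hi).isEmbedding.toHomeomorph
  exact (hX.no_circle _).false (he.symm.trans (AddCircle.homeomorphCircle hp.out.ne'))

instance [h : Fact (IsDendrite X)] : T2Space X := by
  have := h.out.metrizable
  infer_instance

instance [h : Fact (IsDendrite X)] : CompactSpace X := h.out.compact

instance [h : Fact (IsDendrite X)] : ConnectedSpace X := h.out.connected

instance [h : Fact (IsDendrite X)] : LocallyConnectedSpace X := h.out.locallyConnected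

theorem IsArcParam.mono {α : ℝ → X} {a b c d : ℝ} (h : IsArcParam α a b) (hac : a ≤ c) (hcd : c < d)
    (hdb : d ≤ b) : IsArcParam α c d :=
  ⟨hcd, h.2.1.mono (Icc_subset_Icc hac hdb), h.2.2.mono (Icc_subset_Icc hac hdb)⟩

theorem IsArcParam.reverse {α : ℝ → X} {a b : ℝ} (h : IsArcParam α a b) :
    IsArcParam (fun t => α (-t)) (-b) (-a) := by
  have hm : MapsTo (fun t : ℝ => -t) (Icc (-b) (-a)) (Icc a b) := fun t ht =>
    ⟨by linarith [ht.2], by linarith [ht.1]⟩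
  exact ⟨neg_lt_neg h.1, h.2.1.comp continuous_neg.continuousOn hm,
    h.2.2.comp neg_injective.injOn hm⟩

/-- The segment between `x` and `y`: the points in all connected sets containing `x` and `y`. -/
def seg (x y : X) : Set X :=
  {z | ∀ C : Set X, IsPreconnected C → x ∈ C → y ∈ C → z ∈ C}

theorem seg_subset {C : Set X} (hC : IsPreconnected C) {x y : X} (hx : x ∈ C) (hy : y ∈ C) :
    seg x y ⊆ C := fun _ hz => hz C hC hx hy

theorem left_mem_seg (x y : X) : x ∈ seg x y := fun _ _ hx _ => hx

theorem right_mem_seg (x y : X) : y ∈ seg x y := fun _ _ _ hy => hy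

theorem seg_comm (x y : X) : seg x y = seg y x := by
  ext z
  exact ⟨fun h C hC hx hy => h C hC hy hx, fun h C hC hx hy => h C hC hy hx⟩

theorem seg_self (x : X) : seg x x = {x} :=
  (seg_subset isPreconnected_singleton rfl rfl).antisymm
    (singleton_subset_iff.2 (left_mem_seg x x))

variable [hX : Fact (IsDendrite X)]

/-- Two arcs with common endpoints cannot be disjoint otherwise. -/
theorem not_disjoint_arcs {α β : ℝ → X} {a b c d : ℝ} (hα : IsArcParam α a b)
    (hβ : IsArcParam β c d) (hac : α a = β c) (hbd : α b = β d)
    (hdisj : ∀ s ∈ Ioo a b, ∀ t ∈ Icc c d, α s ≠ β t) : False := by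
  obtain ⟨hab, hαc, hαi⟩ := hα
  obtain ⟨hcd, hβc, hβi⟩ := hβ
  -- F runs along α and returns along β reversed, giving a circle.
  set F : ℝ → X := fun r => if r ≤ b then α r else β (d - (r - b)) with hF
  have hc : ContinuousOn F (Icc a (b + (d - c))) := by
    have hun : Icc a (b + (d - c)) = Icc a b ∪ Icc b (b + (d - c)) :=
      (Icc_union_Icc_eq_Icc hab.le (by linarith)).symm
    rw [hun]
    refine ContinuousOn.union_of_isClosed ?_ ?_ isClosed_Icc isClosed_Icc
    · exact hαc.congr fun r hr => by simp [hF, hr.2]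
    · have : ContinuousOn (fun r => β (d - (r - b))) (Icc b (b + (d - c))) := by
        refine hβc.comp (by fun_prop) fun r hr => ⟨?_, ?_⟩ <;> linarith [hr.1, hr.2]
      refine this.congr fun r hr => ?_
      by_cases h : r ≤ b
      · have : r = b := le_antisymm h hr.1
        simp [hF, this, hbd]
      · simp [hF, h]
  refine hX.out.not_loop (show a < b + (d - c) by linarith) hc ?_ ?_
  · have hcase : ∀ r ∈ Ico a (b + (d - c)), ∀ r' ∈ Ico a (b + (d - c)), r ≤ b → ¬ r' ≤ b →
        F r ≠ F r' := by
      intro r hr r' hr' h h' e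
      simp only [hF, h, h', if_true, if_false] at e
      push Not at h'
      have ht : d - (r' - b) ∈ Icc c d := ⟨by linarith [hr'.2], by linarith⟩
      rcases eq_or_lt_of_le hr.1 with e1 | e1
      · rw [← e1, hac] at e
        have := hβi ⟨le_rfl, hcd.le⟩ ht e
        linarith [hr'.2]
      · rcases eq_or_lt_of_le h with e2 | e2
        · rw [e2, hbd] at e
          have := hβi ⟨hcd.le, le_rfl⟩ ht e
          linarith
        · exact hdisj r ⟨e1, e2⟩ _ ht e
    intro r hr r' hr' e
    by_cases h : r ≤ b <;> by_cases h' : r' ≤ b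
    · simp only [hF, h, h', if_true] at e
      exact hαi ⟨hr.1, h⟩ ⟨hr'.1, h'⟩ e
    · exact absurd e (hcase r hr r' hr' h h')
    · exact absurd e.symm (hcase r' hr' r hr h' h)
    · simp only [hF, h, h', if_false] at e
      push Not at h h'
      have := hβi ⟨by linarith [hr.2], by linarith⟩ ⟨by linarith [hr'.2], by linarith⟩ e
      linarith
  · have h : ¬ b + (d - c) ≤ b := by linarith
    simp only [hF, hab.le, h, if_true, if_false]
    rw [hac]
    congr 1
    ring

/-- Distinct points of an open connected set are joined by an arc inside that set. -/
theorem exists_arc_in_open {U : Set X} (hU : IsOpen U) (hUc : IsConnected U) {x y : X} (hx : x ∈ U)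
    (hy : y ∈ U) (hxy : x ≠ y) :
    ∃ (α : ℝ → X) (a b : ℝ), IsArcParam α a b ∧ α a = x ∧ α b = y ∧ α '' Icc a b ⊆ U := by
  have := hX.out.metrizable
  let _ := TopologicalSpace.metrizableSpaceMetric X
  have : LocallyPathConnectedSpace X := locallyPathConnectedSpace_of_compact_locallyConnected
  obtain ⟨γ, hγ⟩ := (hU.isConnected_iff_isPathConnected.1 hUc).joinedIn x hx y hy
  obtain ⟨α, a, b, h, ha, hb, him⟩ := exists_arc_of_path γ.continuous_extend (by simpa using hxy)
  refine ⟨α, a, b, h, by simpa using ha, by simpa using hb, him.trans ?_⟩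
  rintro _ ⟨t, ht, rfl⟩
  rw [Path.extend_apply _ ht]
  exact hγ _

/-- This is uniqueness of arcs. If a connected set joined the endpoints while avoiding α τ, an arc β
would do so too, inside the open component of the complement of α τ. Together with the piece of α
around τ it would contain a circle. -/
theorem IsArcParam.image_eq {α : ℝ → X} {a b : ℝ} (h : IsArcParam α a b) :
    α '' Icc a b = seg (α a) (α b) := by
  have hab := h.1
  refine Subset.antisymm ?_ (seg_subset (isPreconnected_Icc.image _ h.2.1)
    ⟨a, ⟨le_rfl, hab.le⟩, rfl⟩ ⟨b, ⟨hab.le, le_rfl⟩, rfl⟩)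
  rintro _ ⟨τ, hτ, rfl⟩ C hC ha hb
  by_contra hτC
  have hsub : C ⊆ connectedComponentIn {α τ}ᶜ (α a) :=
    hC.subset_connectedComponentIn ha fun z hz e => hτC (e ▸ hz)
  have hane : α a ∈ ({α τ} : Set X)ᶜ := fun e => hτC (e ▸ ha)
  have hxy : α a ≠ α b := fun e =>
    hab.ne (h.2.2 ⟨le_rfl, hab.le⟩ ⟨hab.le, le_rfl⟩ e)
  obtain ⟨β, c, d, hβ, hβc, hβd, hβU⟩ := exists_arc_in_open
    (isOpen_compl_singleton.connectedComponentIn (x := α a))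
    (isConnected_connectedComponentIn_iff.2 hane) (hsub ha) (hsub hb) hxy
  have hτβ : ∀ t ∈ Icc c d, β t ≠ α τ := fun t ht e =>
    connectedComponentIn_subset _ _ (hβU ⟨t, ht, rfl⟩) e
  have hB : IsClosed (β '' Icc c d) := (isCompact_Icc.image_of_continuousOn hβ.2.1).isClosed
  have hA : IsCompact (Icc a b ∩ α ⁻¹' (β '' Icc c d)) :=
    isCompact_Icc.of_isClosed_subset (h.2.1.preimage_isClosed_of_isClosed isClosed_Icc hB)
      inter_subset_left
  -- The last meeting with β before τ and the first one after τ bound a piece of α whose interior is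
  -- disjoint from β.
  obtain ⟨s₀, hs₀, hs₀m⟩ := (hA.inter_right (isClosed_Iic (a := τ))).exists_isGreatest
    ⟨a, ⟨⟨le_rfl, hab.le⟩, c, ⟨le_rfl, hβ.1.le⟩, hβc⟩, hτ.1⟩
  obtain ⟨s₁, hs₁, hs₁m⟩ := (hA.inter_right (isClosed_Ici (a := τ))).exists_isLeast
    ⟨b, ⟨⟨hab.le, le_rfl⟩, d, ⟨hβ.1.le, le_rfl⟩, hβd⟩, hτ.2⟩
  obtain ⟨⟨hs₀I, u₀, hu₀, e₀⟩, hs₀τ⟩ := hs₀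
  obtain ⟨⟨hs₁I, u₁, hu₁, e₁⟩, hs₁τ⟩ := hs₁
  have h₀ : s₀ < τ := lt_of_le_of_ne hs₀τ fun e => hτβ u₀ hu₀ (by rw [e₀, e])
  have h₁ : τ < s₁ := lt_of_le_of_ne hs₁τ fun e => hτβ u₁ hu₁ (by rw [e₁, e])
  have hα' : IsArcParam α s₀ s₁ := h.mono hs₀I.1 (h₀.trans h₁) hs₁I.2
  have hdisj : ∀ s ∈ Ioo s₀ s₁, ∀ t ∈ Icc c d, α s ≠ β t := by
    intro s hs t ht e
    have hsA : s ∈ Icc a b ∩ α ⁻¹' (β '' Icc c d) :=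
      ⟨⟨hs₀I.1.trans hs.1.le, hs.2.le.trans hs₁I.2⟩, t, ht, e.symm⟩
    rcases le_total s τ with hsτ | hsτ
    · exact absurd (hs₀m ⟨hsA, hsτ⟩) (not_le.2 hs.1)
    · exact absurd (hs₁m ⟨hsA, hsτ⟩) (not_le.2 hs.2)
  rcases lt_trichotomy u₀ u₁ with hu | hu | hu
  · exact not_disjoint_arcs hα' (hβ.mono hu₀.1 hu hu₁.2) e₀.symm e₁.symm
      fun s hs t ht => hdisj s hs t ⟨hu₀.1.trans ht.1, ht.2.trans hu₁.2⟩
  · have : α s₀ = α s₁ := by rw [← e₀, ← e₁, hu]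
    exact hα'.1.ne (h.2.2 hs₀I hs₁I this)
  · refine not_disjoint_arcs hα' (hβ.mono hu₁.1 hu hu₀.2).reverse
      (by simp [e₀]) (by simp [e₁]) fun s hs t ht => hdisj s hs _ ⟨?_, ?_⟩
    · linarith [hu₁.1, ht.2]
    · linarith [hu₀.2, ht.1]

theorem exists_arcParam {x y : X} (hxy : x ≠ y) :
    ∃ (α : ℝ → X) (a b : ℝ), IsArcParam α a b ∧ α a = x ∧ α b = y ∧ α '' Icc a b = seg x y := by
  obtain ⟨α, a, b, h, ha, hb, -⟩ := exists_arc_in_open isOpen_univ isConnected_univ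
    (mem_univ x) (mem_univ y) hxy
  exact ⟨α, a, b, h, ha, hb, by rw [h.image_eq, ha, hb]⟩

end Arcs

/-! ### The order on a dendrite rooted at a point. -/

section Segments

variable {X : Type*} [TopologicalSpace X] [hX : Fact (IsDendrite X)]

theorem isCompact_seg (x y : X) : IsCompact (seg x y) := by
  by_cases h : x = y
  · rw [h, seg_self]; exact isCompact_singleton
  · obtain ⟨α, a, b, hα, -, -, e⟩ := exists_arcParam h
    rw [← e]
    exact isCompact_Icc.image_of_continuousOn hα.2.1

theorem isPreconnected_seg (x y : X) : IsPreconnected (seg x y) := by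
  by_cases h : x = y
  · rw [h, seg_self]; exact isPreconnected_singleton
  · obtain ⟨α, a, b, hα, -, -, e⟩ := exists_arcParam h
    rw [← e]
    exact isPreconnected_Icc.image _ hα.2.1

theorem isClosed_seg (x y : X) : IsClosed (seg x y) := (isCompact_seg x y).isClosed

theorem seg_subset_seg {x y u v : X} (hu : u ∈ seg x y) (hv : v ∈ seg x y) : seg u v ⊆ seg x y :=
  seg_subset (isPreconnected_seg x y) hu hv

theorem seg_subset_left {x y u : X} (hu : u ∈ seg x y) : seg x u ⊆ seg x y :=
  seg_subset_seg (left_mem_seg x y) hu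

theorem seg_subset_right {x y u : X} (hu : u ∈ seg x y) : seg u y ⊆ seg x y :=
  seg_subset_seg hu (right_mem_seg x y)

theorem seg_subset_union (x y z : X) : seg x y ⊆ seg x z ∪ seg z y :=
  seg_subset ((isPreconnected_seg x z).union z (right_mem_seg x z) (left_mem_seg z y)
    (isPreconnected_seg z y)) (Or.inl (left_mem_seg x z)) (Or.inr (right_mem_seg z y))

theorem IsArcParam.seg_eq {α : ℝ → X} {a b s t : ℝ} (h : IsArcParam α a b) (hs : a ≤ s)
    (hst : s ≤ t) (ht : t ≤ b) : seg (α s) (α t) = α '' Icc s t := by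
  rcases eq_or_lt_of_le hst with rfl | hlt
  · simp [seg_self]
  · exact (h.mono hs hlt ht).image_eq.symm

/-- With x ≤ y meaning that x lies on `seg p y`, the points below a given one are linearly ordered.
`seg_antisymm` and `mem_seg_trans` make this a partial order. -/
theorem seg_linear {x y z w : X} (hz : z ∈ seg x y) (hw : w ∈ seg x y) :
    z ∈ seg x w ∨ w ∈ seg x z := by
  by_cases h : x = y
  · subst h
    rw [seg_self] at hz hw
    rw [hz, hw]; exact Or.inl (left_mem_seg _ _)
  · obtain ⟨α, a, b, hα, rfl, -, e⟩ := exists_arcParam h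
    rw [← e] at hz hw
    obtain ⟨s, hs, rfl⟩ := hz
    obtain ⟨t, ht, rfl⟩ := hw
    rw [hα.seg_eq le_rfl hs.1 hs.2, hα.seg_eq le_rfl ht.1 ht.2]
    rcases le_total s t with hst | hst
    · exact Or.inl ⟨s, ⟨hs.1, hst⟩, rfl⟩
    · exact Or.inr ⟨t, ⟨ht.1, hst⟩, rfl⟩

theorem seg_antisymm {x z w : X} (hz : z ∈ seg x w) (hw : w ∈ seg x z) : z = w := by
  by_cases h : x = w
  · subst h
    rw [seg_self] at hz
    exact hz
  · obtain ⟨α, a, b, hα, rfl, rfl, e⟩ := exists_arcParam h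
    rw [← e] at hz
    obtain ⟨s, hs, rfl⟩ := hz
    rw [hα.seg_eq le_rfl hs.1 hs.2] at hw
    obtain ⟨t, ht, e⟩ := hw
    have := hα.2.2 ⟨ht.1, ht.2.trans hs.2⟩ ⟨hα.1.le, le_rfl⟩ e
    have : s = b := le_antisymm hs.2 (this ▸ ht.2)
    rw [this]

theorem mem_seg_trans {x y z w : X} (hz : z ∈ seg x y) (hw : w ∈ seg x z) : w ∈ seg x y :=
  seg_subset_left hz hw

theorem mem_seg_right {x y z w : X} (hz : z ∈ seg x y) (hw : w ∈ seg x z) : z ∈ seg w y := by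
  rcases seg_subset_union x y w hz with h | h
  · rw [seg_antisymm hw h]; exact left_mem_seg _ _
  · exact h

/-- The set contains with y the whole component of y in the complement of x, which is open by local
connectedness. -/
theorem isOpen_setOf_lt (p x : X) : IsOpen {y | x ∈ seg p y ∧ y ≠ x} := by
  by_cases hpx : p = x
  · subst hpx
    have : {y | p ∈ seg p y ∧ y ≠ p} = {p}ᶜ := by
      ext y; simp [left_mem_seg]
    rw [this]; exact isOpen_compl_singleton
  · rw [isOpen_iff_mem_nhds]
    rintro y ⟨hy, hyx⟩
    refine mem_of_superset ((isOpen_compl_singleton.connectedComponentIn).mem_nhds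
      (mem_connectedComponentIn (show y ∈ ({x} : Set X)ᶜ from hyx))) ?_
    intro z hz
    refine ⟨fun C hC hp hzC => ?_, fun e => connectedComponentIn_subset _ _ hz e⟩
    by_contra hxC
    have hun : IsPreconnected (C ∪ connectedComponentIn {x}ᶜ y) :=
      hC.union z hzC hz isPreconnected_connectedComponentIn
    rcases hy _ hun (Or.inl hp) (Or.inr (mem_connectedComponentIn hyx)) with h | h
    · exact hxC h
    · exact connectedComponentIn_subset _ _ h rfl

theorem isClosed_setOf_le (p x : X) : IsClosed {y | x ∈ seg p y} := by
  rw [← isOpen_compl_iff, isOpen_iff_mem_nhds]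
  intro y hy
  obtain ⟨C, hC, hp, hyC, hx⟩ : ∃ C : Set X, IsPreconnected C ∧ p ∈ C ∧ y ∈ C ∧ x ∉ C := by
    by_contra! h
    exact hy fun C hC hp hyC => h C hC hp hyC
  have hsub : C ⊆ connectedComponentIn {x}ᶜ p :=
    hC.subset_connectedComponentIn hp fun z hz e => hx (e ▸ hz)
  refine mem_of_superset ((isOpen_compl_singleton.connectedComponentIn).mem_nhds (hsub hyC)) ?_
  intro z hz hxz
  exact connectedComponentIn_subset _ _
    (seg_subset isPreconnected_connectedComponentIn (hsub hp) hz hxz) rfl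

theorem eventually_seg_subset {x : X} {U : Set X} (hU : U ∈ 𝓝 x) : ∀ᶠ y in 𝓝 x, seg x y ⊆ U := by
  obtain ⟨V, hVU, hVo, hxV, hVc⟩ := locallyConnectedSpace_iff_subsets_isOpen_isConnected.1
    (inferInstanceAs (LocallyConnectedSpace X)) x U hU
  filter_upwards [hVo.mem_nhds hxV] with y hy
  exact (seg_subset hVc.isPreconnected hxV hy).trans hVU

theorem exists_mem_seg_near {u v : X} (huv : u ≠ v) {W : Set X} (hW : W ∈ 𝓝 u) :
    ∃ w ∈ seg u v, w ∈ W ∧ w ≠ u ∧ w ≠ v := by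
  obtain ⟨α, a, b, hα, rfl, rfl, e⟩ := exists_arcParam huv
  have hab := hα.1
  have h1 : ∀ᶠ t in 𝓝[>] a, α t ∈ W := by
    have := (hα.2.1 a ⟨le_rfl, hab.le⟩).mono (Ioo_subset_Icc_self)
    have h2 : Tendsto α (𝓝[Ioo a b] a) (𝓝 (α a)) := this
    rw [nhdsWithin_Ioo_eq_nhdsGT hab] at h2
    exact h2 hW
  obtain ⟨t, htW, ht⟩ := (h1.and (Ioo_mem_nhdsGT hab)).exists
  refine ⟨α t, e ▸ ⟨t, ⟨ht.1.le, ht.2.le⟩, rfl⟩, htW, fun h => ?_, fun h => ?_⟩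
  · exact ht.1.ne' (hα.2.2 ⟨ht.1.le, ht.2.le⟩ ⟨le_rfl, hab.le⟩ h)
  · exact ht.2.ne (hα.2.2 ⟨ht.1.le, ht.2.le⟩ ⟨hab.le, le_rfl⟩ h)

theorem exists_mem_seg_between {u v : X} (huv : u ≠ v) : ∃ w ∈ seg u v, w ≠ u ∧ w ≠ v := by
  obtain ⟨w, hw, -, h⟩ := exists_mem_seg_near huv univ_mem
  exact ⟨w, hw, h⟩

/-- Two segments starting at `e` overlap near `e` unless `e` lies between their other endpoints. -/
theorem exists_common_of_notMem_seg {e y w : X} (h : e ∉ seg y w) :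
    ∃ v, v ≠ e ∧ v ∈ seg e y ∧ v ∈ seg e w := by
  refine (isPreconnected_seg y w).induction₂ (fun a b => ∃ v, v ≠ e ∧ v ∈ seg e a ∧ v ∈ seg e b)
    ?_ ?_ ?_ (left_mem_seg y w) (right_mem_seg y w)
  · intro a ha
    have hae : e ≠ a := fun h' => h (h' ▸ ha)
    obtain ⟨v, hv, hve, hva⟩ := exists_mem_seg_between hae
    filter_upwards [mem_nhdsWithin_of_mem_nhds ((isOpen_setOf_lt e v).mem_nhds ⟨hv, hva.symm⟩)]
      with z hz
    exact ⟨v, hve, hv, hz.1⟩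
  · rintro a b c - - - ⟨v, hve, hva, hvb⟩ ⟨v', hve', hvb', hvc'⟩
    rcases seg_linear hvb hvb' with h' | h'
    · exact ⟨v, hve, hva, mem_seg_trans hvc' h'⟩
    · exact ⟨v', hve', mem_seg_trans hva h', hvc'⟩
  · rintro a b - - ⟨v, h1, h2, h3⟩
    exact ⟨v, h1, h3, h2⟩

omit hX in
theorem isCutpoint_of_mem_seg {u v z : X} (hz : z ∈ seg u v) (hu : z ≠ u) (hv : z ≠ v) :
    IsCutpoint z := fun h => hz _ h hu.symm hv.symm rfl

/-- The image is an arc with the right endpoints, and such an arc is unique. -/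
theorem image_seg {f : X → X} (hf : Continuous f) {x y : X} (hinj : InjOn f (seg x y)) :
    f '' seg x y = seg (f x) (f y) := by
  by_cases h : x = y
  · subst h; simp [seg_self]
  · obtain ⟨α, a, b, hα, rfl, rfl, e⟩ := exists_arcParam h
    have : IsArcParam (fun t => f (α t)) a b :=
      ⟨hα.1, hf.comp_continuousOn hα.2.1, hinj.comp hα.2.2 fun t ht => e ▸ ⟨t, ht, rfl⟩⟩
    rw [← e, image_image]
    exact this.image_eq

theorem map_mem_seg {f : X → X} (hf : Continuous f) {x y z : X} (hinj : InjOn f (seg x y))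
    (hz : z ∈ seg x y) : f z ∈ seg (f x) (f y) :=
  image_seg hf hinj ▸ ⟨z, hz, rfl⟩

/-- A decreasing sequence in a segment converges. -/
theorem exists_tendsto_of_antitone {t : X} {z : ℕ → X} (hz : ∀ n, z (n + 1) ∈ seg t (z n)) :
    ∃ s, Tendsto z atTop (𝓝 s) ∧ ∀ n, s ∈ seg t (z n) := by
  have hz0 : ∀ n, z n ∈ seg t (z 0) := by
    intro n
    induction n with
    | zero => exact right_mem_seg _ _
    | succ n ih => exact mem_seg_trans ih (hz n)
  have hzm : ∀ n m, n ≤ m → z m ∈ seg t (z n) := by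
    intro n m h
    induction m, h using Nat.le_induction with
    | base => exact right_mem_seg _ _
    | succ m _ ih => exact mem_seg_trans ih (hz m)
  suffices ∃ s, Tendsto z atTop (𝓝 s) by
    obtain ⟨s, hs⟩ := this
    refine ⟨s, hs, fun n => (isClosed_seg t (z n)).mem_of_tendsto hs ?_⟩
    filter_upwards [eventually_ge_atTop n] with m hm using hzm n m hm
  by_cases h : t = z 0
  · have : ∀ n, z n = t := fun n => by
      have := hz0 n
      rwa [← h, seg_self] at this
    exact ⟨t, tendsto_const_nhds.congr fun n => (this n).symm⟩
  · obtain ⟨α, a, b, hα, e1, -, e⟩ := exists_arcParam h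
    have hex : ∀ n, ∃ r ∈ Icc a b, α r = z n := fun n => by
      have := hz0 n
      rwa [← e] at this
    choose r hr hrz using hex
    have hanti : Antitone r := antitone_nat_of_succ_le fun n => by
      have := hz n
      rw [← hrz n, ← hrz (n + 1), ← e1, hα.seg_eq le_rfl (hr n).1 (hr n).2] at this
      obtain ⟨q, hq, hqe⟩ := this
      rw [← hα.2.2 ⟨hq.1, hq.2.trans (hr n).2⟩ (hr (n + 1)) hqe]
      exact hq.2
    have hlim := tendsto_atTop_ciInf hanti ⟨a, by rintro _ ⟨n, rfl⟩; exact (hr n).1⟩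
    have hmem : (⨅ n, r n) ∈ Icc a b := isClosed_Icc.mem_of_tendsto hlim (Eventually.of_forall hr)
    refine ⟨α (⨅ n, r n), ?_⟩
    have := (hα.2.1 _ hmem).tendsto.comp
      (tendsto_nhdsWithin_iff.2 ⟨hlim, Eventually.of_forall hr⟩)
    refine this.congr fun n => hrz n

/-- An increasing sequence for the order rooted at `q` converges to an upper bound. -/
theorem exists_tendsto_of_monotone {q : X} {x : ℕ → X} (hx : ∀ n, x n ∈ seg q (x (n + 1))) :
    ∃ s, Tendsto x atTop (𝓝 s) ∧ ∀ n, x n ∈ seg q s := by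
  have hxm : ∀ n m, n ≤ m → x n ∈ seg q (x m) := by
    intro n m h
    induction m, h using Nat.le_induction with
    | base => exact right_mem_seg _ _
    | succ m _ ih => exact mem_seg_trans (hx m) ih
  -- Compactness gives a common upper bound e; seen from e, the sequence is decreasing on a segment.
  obtain ⟨e, he⟩ := IsCompact.nonempty_iInter_of_sequence_nonempty_isCompact_isClosed
    (fun n => {y | x n ∈ seg q y}) (fun n y hy => mem_seg_trans hy (hx n))
    (fun n => ⟨x n, right_mem_seg _ _⟩) (isClosed_setOf_le _ _).isCompact
    (fun n => isClosed_setOf_le _ _)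
  rw [mem_iInter] at he
  obtain ⟨s, hs, -⟩ := exists_tendsto_of_antitone (t := e) (z := x) fun n => by
    rw [seg_comm]
    exact mem_seg_right (he (n + 1)) (hx n)
  refine ⟨s, hs, fun n => (isClosed_setOf_le q (x n)).mem_of_tendsto hs ?_⟩
  filter_upwards [eventually_ge_atTop n] with m hm using hxm n m hm

theorem tendsto_of_mem_seg {q : X} {z w : ℕ → X} (hz : Tendsto z atTop (𝓝 q))
    (hw : ∀ n, w n ∈ seg q (z n)) : Tendsto w atTop (𝓝 q) := by
  intro U hU
  rw [mem_map]
  filter_upwards [hz.eventually (eventually_seg_subset hU)] with n hn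
  exact hn (hw n)

/-- A path in a dendrite without folds in its interior is injective. -/
theorem injOn_of_locally_injective {β : ℝ → X} {a b : ℝ} (hβ : ContinuousOn β (Icc a b))
    (hloc : ∀ t ∈ Ioo a b, ∃ ε > 0, InjOn β (Ioo (t - ε) (t + ε) ∩ Icc a b)) :
    InjOn β (Icc a b) := by
  have main : ∀ c d, a < c → d < b → InjOn β (Icc c d) := by
    intro c d hac hdb
    by_contra hni
    have hU : ∀ t : ℝ, ∃ ε > 0, t ∈ Icc c d → InjOn β (Ioo (t - ε) (t + ε) ∩ Icc a b) := by
      intro t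
      by_cases ht : t ∈ Icc c d
      · obtain ⟨ε, hε, h⟩ := hloc t ⟨hac.trans_le ht.1, ht.2.trans_lt hdb⟩
        exact ⟨ε, hε, fun _ => h⟩
      · exact ⟨1, one_pos, fun h => absurd h ht⟩
    choose ε hε hεi using hU
    obtain ⟨δ, hδ, hL⟩ := lebesgue_number_lemma_of_metric (isCompact_Icc (a := c) (b := d))
      (c := fun t : Icc c d => Ioo ((t : ℝ) - ε t) (t + ε t)) (fun t => isOpen_Ioo)
      (fun t ht => mem_iUnion.2 ⟨⟨t, ht⟩, by constructor <;> linarith [hε t]⟩)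
    have hfar : ∀ s ∈ Icc c d, ∀ t ∈ Icc c d, s < t → β s = β t → s + δ ≤ t := by
      intro s hs t ht hst e
      by_contra! hlt
      obtain ⟨⟨r, hr⟩, hsub⟩ := hL s hs
      have h1 : s ∈ Metric.ball s δ := Metric.mem_ball_self hδ
      have h2 : t ∈ Metric.ball s δ := by
        rw [Metric.mem_ball, Real.dist_eq, abs_of_pos (by linarith)]; linarith
      have := hεi r hr ⟨hsub h1, hac.le.trans hs.1, hs.2.trans hdb.le⟩
        ⟨hsub h2, hac.le.trans ht.1, ht.2.trans hdb.le⟩ e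
      exact hst.ne this
    have hsubI : Icc c d ⊆ Icc a b := Icc_subset_Icc hac.le hdb.le
    -- Local injectivity keeps coincidences β s = β t at parameter distance at least δ, so a closest
    -- such pair exists. Between its two parameters β is a simple loop.
    let P : Set (ℝ × ℝ) := (Icc c d ×ˢ Icc c d) ∩ {p | p.1 + δ ≤ p.2}
    have hPc : IsCompact P := (isCompact_Icc.prod isCompact_Icc).inter_right
      (isClosed_le (by fun_prop) (by fun_prop))
    have hPβ : IsCompact (P ∩ (fun p : ℝ × ℝ => (β p.1, β p.2)) ⁻¹' diagonal X) := by
      refine hPc.of_isClosed_subset (ContinuousOn.preimage_isClosed_of_isClosed ?_ hPc.isClosed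
        isClosed_diagonal) inter_subset_left
      exact ((hβ.mono hsubI).comp continuous_fst.continuousOn fun p hp => hp.1.1).prodMk
        ((hβ.mono hsubI).comp continuous_snd.continuousOn fun p hp => hp.1.2)
    have hne : (P ∩ (fun p : ℝ × ℝ => (β p.1, β p.2)) ⁻¹' diagonal X).Nonempty := by
      simp only [InjOn] at hni
      push Not at hni
      obtain ⟨s, hs, t, ht, e, hst⟩ := hni
      rcases lt_or_gt_of_ne hst with h | h
      · exact ⟨(s, t), ⟨⟨hs, ht⟩, hfar s hs t ht h e⟩, e⟩
      · exact ⟨(t, s), ⟨⟨ht, hs⟩, hfar t ht s hs h e.symm⟩, e.symm⟩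
    obtain ⟨⟨s, t⟩, ⟨⟨⟨hs, ht⟩, hst⟩, e⟩, hmin⟩ := hPβ.exists_isMinOn hne
      (f := fun p : ℝ × ℝ => p.2 - p.1) (by fun_prop)
    dsimp only at hs ht hst e
    have hst : s + δ ≤ t := hst
    have hIcc : Icc s t ⊆ Icc c d := Icc_subset_Icc hs.1 ht.2
    have hmin' : ∀ s' ∈ Icc c d, ∀ t' ∈ Icc c d, s' < t' → β s' = β t' → t - s ≤ t' - s' :=
      fun s' hs' t' ht' hlt e' => hmin (a := (s', t')) ⟨⟨⟨hs', ht'⟩, hfar s' hs' t' ht' hlt e'⟩, e'⟩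
    refine hX.out.not_loop (show s < t by linarith) (hβ.mono (hIcc.trans hsubI)) ?_ e
    intro u hu v hv huv
    have hu' := hIcc (Ico_subset_Icc_self hu)
    have hv' := hIcc (Ico_subset_Icc_self hv)
    by_contra hne
    rcases lt_or_gt_of_ne hne with h | h
    · linarith [hmin' u hu' v hv' h huv, hu.1, hv.2]
    · linarith [hmin' v hv' u hu' h huv.symm, hu.2, hv.1]
  have hIoo : InjOn β (Ioo a b) := by
    intro s hs t ht e
    exact main (min s t) (max s t) (lt_min hs.1 ht.1) (max_lt hs.2 ht.2)
      (show s ∈ Icc _ _ from ⟨min_le_left _ _, le_max_left _ _⟩)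
      (show t ∈ Icc _ _ from ⟨min_le_right _ _, le_max_right _ _⟩) e
  have hsplit : ∀ s ∈ Icc a b, ∀ t ∈ Icc a b, s < t → β s ≠ β t := by
    have hright : ∀ s ∈ Ioo a b, β s ≠ β b := fun s hs =>
      hX.out.not_loop hs.2 (hβ.mono (Icc_subset_Icc_left hs.1.le))
        (hIoo.mono fun r hr => (⟨hs.1.trans_le hr.1, hr.2⟩ : r ∈ Ioo a b))
    have hleft : ∀ t ∈ Ioo a b, β a ≠ β t := by
      intro t ht e
      have hc : ContinuousOn (fun r => β (-r)) (Icc (-t) (-a)) :=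
        hβ.comp continuous_neg.continuousOn fun r hr =>
          ⟨by linarith [hr.2], by linarith [hr.1, ht.2]⟩
      refine hX.out.not_loop (neg_lt_neg ht.1) hc ?_ (by simpa using e.symm)
      intro u hu v hv huv
      have := hIoo ⟨by linarith [hu.2], by linarith [hu.1, ht.2]⟩
        ⟨by linarith [hv.2], by linarith [hv.1, ht.2]⟩ huv
      linarith
    intro s hs t ht hst
    rcases eq_or_lt_of_le hs.1 with h1 | h1 <;> rcases eq_or_lt_of_le ht.2 with h2 | h2
    · rw [← h1, h2]
      refine hX.out.not_loop (by linarith) hβ ?_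
      intro u hu v hv huv
      rcases eq_or_lt_of_le hu.1 with e1 | e1 <;> rcases eq_or_lt_of_le hv.1 with e2 | e2
      · rw [← e1, ← e2]
      · rw [← e1] at huv
        exact absurd huv (hleft v ⟨e2, hv.2⟩)
      · rw [← e2] at huv
        exact absurd huv.symm (hleft u ⟨e1, hu.2⟩)
      · exact hIoo ⟨e1, hu.2⟩ ⟨e2, hv.2⟩ huv
    · rw [← h1]; exact hleft t ⟨by linarith, h2⟩
    · rw [h2]; exact hright s ⟨h1, by linarith⟩
    · intro e
      exact hst.ne (hIoo ⟨h1, by linarith⟩ ⟨by linarith, h2⟩ e)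
  intro s hs t ht e
  by_contra hne
  rcases lt_or_gt_of_ne hne with h | h
  · exact hsplit s hs t ht h e
  · exact hsplit t ht s hs h e.symm

/-- The endpoints may be critical: folds are excluded by local injectivity at interior parameters
alone. -/
theorem injOn_seg_of_not_critical {f : X → X} (hf : Continuous f) {x y : X}
    (h : ∀ z ∈ seg x y, z ≠ x → z ≠ y → ¬ IsCriticalPoint f z) : InjOn f (seg x y) := by
  by_cases hxy : x = y
  · subst hxy; rw [seg_self]; exact injOn_singleton f _
  · obtain ⟨α, a, b, hα, rfl, rfl, e⟩ := exists_arcParam hxy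
    have hab := hα.1
    have hinj : InjOn (fun t => f (α t)) (Icc a b) := by
      refine injOn_of_locally_injective (hf.comp_continuousOn hα.2.1) fun t ht => ?_
      have htI := Ioo_subset_Icc_self ht
      have hncrit := h (α t) (e ▸ ⟨t, htI, rfl⟩)
        (fun h => ht.1.ne' (hα.2.2 htI ⟨le_rfl, hab.le⟩ h))
        (fun h => ht.2.ne (hα.2.2 htI ⟨hab.le, le_rfl⟩ h))
      simp only [IsCriticalPoint] at hncrit
      push Not at hncrit
      obtain ⟨U, hU, hUi⟩ := hncrit
      obtain ⟨ε, hε, hb⟩ := Metric.mem_nhdsWithin_iff.1 ((hα.2.1 t htI) hU)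
      refine ⟨ε, hε, fun u hu v hv huv => ?_⟩
      rw [← Real.ball_eq_Ioo] at hu hv
      exact hα.2.2 hu.2 hv.2 (hUi (hb hu) (hb hv) huv)
    rw [← e]
    rintro _ ⟨s, hs, rfl⟩ _ ⟨t, ht, rfl⟩ hst
    rw [hinj hs ht hst]

theorem injOn_seg_of_injOn_initial {f : X → X} (hf : Continuous f) {x y : X}
    (h : ∀ z ∈ seg x y, z ≠ y → InjOn f (seg x z)) : InjOn f (seg x y) := by
  by_cases hxy : x = y
  · subst hxy; rw [seg_self]; exact injOn_singleton f _
  · obtain ⟨α, a, b, hα, rfl, rfl, e⟩ := exists_arcParam hxy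
    have hab := hα.1
    have hinj : InjOn (fun t => f (α t)) (Icc a b) := by
      refine injOn_of_locally_injective (hf.comp_continuousOn hα.2.1) fun t ht => ?_
      refine ⟨(b - t) / 2, by linarith [ht.2], ?_⟩
      have hs : (t + b) / 2 ∈ Icc a b := by constructor <;> linarith [ht.1, ht.2]
      have := h (α ((t + b) / 2)) (e ▸ ⟨_, hs, rfl⟩) fun h' => by
        have := hα.2.2 hs ⟨hab.le, le_rfl⟩ h'
        linarith [ht.2]
      rw [hα.seg_eq le_rfl hs.1 hs.2] at this
      intro u hu v hv huv
      exact hα.2.2 hu.2 hv.2 (this ⟨u, ⟨hu.2.1, by linarith [hu.1.2]⟩, rfl⟩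
        ⟨v, ⟨hv.2.1, by linarith [hv.1.2]⟩, rfl⟩ huv)
    rw [← e]
    rintro _ ⟨s, hs, rfl⟩ _ ⟨t, ht, rfl⟩ hst
    rw [hinj hs ht hst]

/-- Zorn's lemma for the order rooted at `p`. -/
theorem exists_maximal_of_chain_closed (p : X) {S : Set X} (hS : S.Nonempty)
    (h : ∀ c ⊆ S, c.Nonempty → ∀ e, (∀ x ∈ c, e ∈ closure {y ∈ c | x ∈ seg p y}) →
      (∀ x ∈ c, x ∈ seg p e) → (∀ u, (∀ x ∈ c, x ∈ seg p u) → e ∈ seg p u) → e ∈ S) :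
    ∃ m ∈ S, ∀ x ∈ S, m ∈ seg p x → x = m := by
  obtain ⟨s₀, hs₀⟩ := hS
  have hz := exists_maximal_of_chains_bounded (α := S) (r := fun x y => (x : X) ∈ seg p y) ?_ ?_
  · obtain ⟨m, hm⟩ := hz
    exact ⟨m, m.2, fun x hx hmx => seg_antisymm (hm ⟨x, hx⟩ hmx) hmx⟩
  · intro c hc
    rcases c.eq_empty_or_nonempty with rfl | hne
    · exact ⟨⟨s₀, hs₀⟩, by simp⟩
    have htot : ∀ x ∈ c, ∀ y ∈ c, (x : X) ∈ seg p y ∨ (y : X) ∈ seg p x := by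
      intro x hx y hy
      by_cases hxy : x = y
      · rw [hxy]; exact Or.inl (right_mem_seg _ _)
      · exact hc hx hy hxy
    set c' : Set X := Subtype.val '' c with hc'
    have : Nonempty c := hne.to_subtype
    -- e is a cluster point of the chain along its upper tails. It is the supremum of the chain.
    obtain ⟨e, he⟩ := IsCompact.nonempty_iInter_of_directed_nonempty_isCompact_isClosed
      (fun x : c => closure {y ∈ c' | (x : X) ∈ seg p y}) (by
        intro x y
        rcases htot x x.2 y y.2 with hxy | hxy
        · exact ⟨y, closure_mono fun z hz => ⟨hz.1, mem_seg_trans hz.2 hxy⟩, Subset.rfl⟩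
        · exact ⟨x, Subset.rfl, closure_mono fun z hz => ⟨hz.1, mem_seg_trans hz.2 hxy⟩⟩)
      (fun x => ⟨x, subset_closure ⟨⟨x, x.2, rfl⟩, right_mem_seg _ _⟩⟩)
      (fun x => isClosed_closure.isCompact) (fun x => isClosed_closure)
    rw [mem_iInter] at he
    have he1 : ∀ x ∈ c', e ∈ closure {y ∈ c' | x ∈ seg p y} := by
      rintro _ ⟨x, hx, rfl⟩
      exact he ⟨x, hx⟩
    have he2 : ∀ x ∈ c', x ∈ seg p e := fun x hx =>
      closure_minimal (fun y hy => hy.2) (isClosed_setOf_le p x) (he1 x hx)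
    have heS : e ∈ S := by
      refine h c' ?_ (hne.image _) e he1 he2 fun u hu => ?_
      · rintro _ ⟨x, -, rfl⟩; exact x.2
      · obtain ⟨x, hx⟩ := hne
        exact closure_minimal (fun y hy => hu y hy.1) (isClosed_seg p u) (he1 x ⟨x, hx, rfl⟩)
    exact ⟨⟨e, heS⟩, fun a ha => he2 a ⟨a, ha, rfl⟩⟩
  · intro a b c hab hbc
    exact mem_seg_trans hbc hab

/-- By continuity g e is an upper bound of c, since x ≤ y ≤ g y for all y in c above x; and e is the
least upper bound. -/
theorem sup_le_map {g : X → X} (hg : Continuous g) {p e : X} {c : Set X}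
    (hc : ∀ x ∈ c, x ∈ seg p (g x)) (he : ∀ x ∈ c, e ∈ closure {y ∈ c | x ∈ seg p y})
    (hlub : ∀ u, (∀ x ∈ c, x ∈ seg p u) → e ∈ seg p u) : e ∈ seg p (g e) :=
  hlub _ fun x hx => closure_minimal (t := g ⁻¹' {y | x ∈ seg p y})
    (fun _ hy => mem_seg_trans (hc _ hy.1) hy.2) ((isClosed_setOf_le p x).preimage hg) (he x hx)

/-- Choose w strictly between m and v, hence strictly below g m. Points y of `seg m w` near m still
have images beyond w, so y < g y. Thus a non-fixed m with m ≤ g m is never maximal, and it can be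
pushed in the direction of any v on `seg m (g m)`. -/
theorem exists_push_up {g : X → X} (hg : Continuous g) {p m v : X} (hm : m ∈ seg p (g m))
    (hv : v ∈ seg m (g m)) (hvm : v ≠ m) :
    ∃ y, y ≠ m ∧ y ∈ seg m v ∧ m ∈ seg p y ∧ y ∈ seg p (g y) ∧ g y ≠ y := by
  obtain ⟨w, hw, hwm, hwv⟩ := exists_mem_seg_between hvm.symm
  have hwg : w ∈ seg m (g m) := seg_subset_left hv hw
  have hne : g m ≠ w := by
    rintro h
    rw [← h] at hwv hw
    exact hwv (seg_antisymm hw hv)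
  have habove : ∀ z ∈ seg m (g m), m ∈ seg p z := by
    intro z hz
    rw [seg_comm] at hm hz ⊢
    exact mem_seg_right hm hz
  have hpw : w ∈ seg p (g m) := seg_subset_right hm hwg
  obtain ⟨y, hy, hyW, hym, hyw⟩ := exists_mem_seg_near hwm.symm
    (((isOpen_setOf_lt p w).preimage hg).mem_nhds ⟨hpw, hne⟩)
  have hypw : y ∈ seg p w := seg_subset_right (habove w hwg) hy
  refine ⟨y, hym, seg_subset_left hw hy, habove y (seg_subset_left hwg hy),
    mem_seg_trans hyW.1 hypw, fun h => ?_⟩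
  have := hyW.1
  rw [h] at this
  exact hyw (seg_antisymm hypw this)

/-- If `g` moves `y` away from `p`, then it has a fixed point beyond `y`. -/
theorem exists_fixed_above {g : X → X} (hg : Continuous g) {p y : X} (hy : y ∈ seg p (g y)) :
    ∃ m, g m = m ∧ y ∈ seg p m := by
  obtain ⟨m, ⟨hym, hm⟩, hmax⟩ := exists_maximal_of_chain_closed p
    (S := {x | y ∈ seg p x ∧ x ∈ seg p (g x)}) ⟨y, right_mem_seg _ _, hy⟩
    (fun c hc ⟨x, hx⟩ e he1 he2 he3 =>
      ⟨mem_seg_trans (he2 x hx) (hc hx).1, sup_le_map hg (fun x hx => (hc hx).2) he1 he3⟩)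
  refine ⟨m, ?_, hym⟩
  by_contra hne
  obtain ⟨z, hzm, -, hmz, hpz, -⟩ := exists_push_up hg hm (right_mem_seg _ _) hne
  exact hzm (hmax z ⟨mem_seg_trans hmz hym, hpz⟩ hmz)

end Segments

/-! ### Arcs on which all iterates are one-to-one. -/

section HomArcs

variable {X : Type*} [TopologicalSpace X]

/-- All iterates of `f` are injective on `S`. -/
def IteratesInjOn (f : X → X) (S : Set X) : Prop := ∀ n : ℕ, InjOn f^[n] S

omit [TopologicalSpace X] in
theorem IteratesInjOn.mono {f : X → X} {S T : Set X} (h : IteratesInjOn f T) (hST : S ⊆ T) :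
    IteratesInjOn f S := fun n => (h n).mono hST

omit [TopologicalSpace X] in
theorem IteratesInjOn.image {f : X → X} {S : Set X} (h : IteratesInjOn f S) (i : ℕ) :
    IteratesInjOn f (f^[i] '' S) := by
  intro n
  refine InjOn.image_of_comp ?_
  rw [← iterate_add]
  exact h (n + i)

omit [TopologicalSpace X] in
theorem isWandering_of_lt {f : X → X} {K : Set X}
    (h : ∀ i j, i < j → ∀ a ∈ K, ∀ b ∈ K, f^[i] a ≠ f^[j] b) : IsWandering f K := by
  intro m n hmn
  rw [Set.disjoint_left]
  rintro _ ⟨a, ha, rfl⟩ ⟨b, hb, e⟩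
  rcases lt_or_gt_of_ne hmn with hlt | hlt
  · exact h m n hlt a ha b hb e.symm
  · exact h n m hlt b hb a ha e

variable [hX : Fact (IsDendrite X)]

theorem isNondegContinuum_seg {x y : X} (h : x ≠ y) : IsNondegContinuum (seg x y) :=
  ⟨isCompact_seg x y, ⟨⟨x, left_mem_seg x y⟩, isPreconnected_seg x y⟩,
    x, left_mem_seg x y, y, right_mem_seg x y, h⟩

variable {f : X → X}

theorem IteratesInjOn.image_seg (hf : Continuous f) {q x : X} (h : IteratesInjOn f (seg q x))
    (i : ℕ) : f^[i] '' seg q x = seg (f^[i] q) (f^[i] x) :=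
  DendriteMap.image_seg (hf.iterate i) (h i)

theorem IteratesInjOn.seg_iterate (hf : Continuous f) {q x : X} (h : IteratesInjOn f (seg q x))
    (i : ℕ) : IteratesInjOn f (seg (f^[i] q) (f^[i] x)) :=
  h.image_seg hf i ▸ h.image i

theorem IteratesInjOn.map_mem (hf : Continuous f) {q x z : X} (h : IteratesInjOn f (seg q x))
    (i : ℕ) (hz : z ∈ seg q x) : f^[i] z ∈ seg (f^[i] q) (f^[i] x) :=
  map_mem_seg (hf.iterate i) (h i) hz

theorem IteratesInjOn.mapsTo (hf : Continuous f) {q x : X} (h : IteratesInjOn f (seg q x)) {k : ℕ}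
    (hq : f^[k] q = q) (hx : f^[k] x ∈ seg q x) : MapsTo f^[k] (seg q x) (seg q x) := by
  intro z hz
  have := h.map_mem hf k hz
  rw [hq] at this
  exact mem_seg_trans hx this

theorem IteratesInjOn.mapsTo_mul (hf : Continuous f) {q x : X} (h : IteratesInjOn f (seg q x))
    {k : ℕ} (hq : f^[k] q = q) (hx : f^[k] x ∈ seg q x) (n : ℕ) :
    MapsTo f^[k * n] (seg q x) (seg q x) := by
  rw [iterate_mul]
  exact (h.mapsTo hf hq hx).iterate n

omit [TopologicalSpace X] hX in
theorem iterate_mul_fixed {k : ℕ} {q : X} (hq : f^[k] q = q) (n : ℕ) : f^[k * n] q = q := by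
  rw [iterate_mul]
  exact iterate_fixed hq n

theorem IteratesInjOn.mapsTo_seg (hf : Continuous f) {q x u : X} (h : IteratesInjOn f (seg q x))
    {k : ℕ} (hq : f^[k] q = q) (hu : u ∈ seg q x) {z : X} (hz : z ∈ seg q u) :
    f^[k] z ∈ seg q (f^[k] u) := by
  have := (h.mono (seg_subset_left hu)).map_mem hf k hz
  rwa [hq] at this

/-- An arc attracted to its endpoint `q` under `f^[d]`, where `d` is the least positive integer
preserving the germ of the arc at `q`, contains a wandering arc. -/
theorem not_attracting_of_minimal (hf : Continuous f) (hwand : NoWanderingContinua f) {q u : X}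
    (hinj : IteratesInjOn f (seg q u)) {d : ℕ} (hd : 0 < d) (hdq : f^[d] q = q)
    (hdu : f^[d] u ∈ seg q u) (hdne : f^[d] u ≠ u)
    (hlim : Tendsto (fun n => f^[d * n] u) atTop (𝓝 q))
    (hmin : ∀ e, 0 < e → f^[e] q = q → ∀ v ∈ seg q u, v ≠ q → f^[e] v ∈ seg q u → d ≤ e) :
    False := by
  -- `seg w u` stays strictly beyond t = f^d u, so it is part of a fundamental domain of f^d; this
  -- is the wandering arc.
  obtain ⟨w, hw, hwt, hwu⟩ := exists_mem_seg_between hdne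
  set t := f^[d] u with ht
  have hwq : w ∈ seg q u := seg_subset_right hdu hw
  have hmaps := hinj.mapsTo_mul hf hdq hdu
  have huq : u ≠ q := by
    rintro rfl
    exact hdne hdq
  have hqw : q ≠ w := by
    rintro rfl
    have h1 : q ∈ seg u t := by rw [seg_comm]; exact hw
    have h2 : t ∈ seg u q := by rw [seg_comm]; exact hdu
    exact hwt (seg_antisymm h1 h2)
  have hK : seg w u ⊆ seg q u := seg_subset_right hwq
  have hqK : q ∉ seg w u := by
    intro h
    rw [seg_comm] at h hwq
    exact hqw (seg_antisymm h hwq)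
  have hto : ∀ z ∈ seg q u, Tendsto (fun n => f^[d * n] z) atTop (𝓝 q) := fun z hz =>
    tendsto_of_mem_seg hlim fun n => hinj.mapsTo_seg hf (iterate_mul_fixed hdq n)
      (right_mem_seg q u) hz
  refine hwand (seg w u) (isNondegContinuum_seg hwu) (isWandering_of_lt ?_)
  intro i j hij a ha b hb hab
  have haq := hK ha
  have hbq := hK hb
  obtain ⟨e, rfl⟩ : ∃ e, j = e + i := ⟨j - i, by omega⟩
  have he : 0 < e := by omega
  have hshift : ∀ l, i ≤ l → f^[e] (f^[d * l] b) = f^[d * l] a := by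
    intro l hl
    have hdl : i ≤ d * l := hl.trans (Nat.le_mul_of_pos_left l hd)
    obtain ⟨m, hm⟩ := Nat.exists_eq_add_of_le' hdl
    rw [hm, iterate_add_apply f m i a, hab, ← iterate_add_apply, ← iterate_add_apply,
      show e + (m + i) = m + (e + i) by omega]
  have heq : f^[e] q = q := by
    have h1 := ((hf.iterate e).tendsto q).comp (hto b hbq)
    refine tendsto_nhds_unique h1 ((hto a haq).congr' ?_)
    filter_upwards [eventually_ge_atTop i] with l hl
    exact (hshift l hl).symm
  have hne : ∀ n, f^[d * n] b ≠ q := fun n h => by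
    have : f^[d * n] b = f^[d * n] q := by rw [h, iterate_mul_fixed hdq]
    exact hqK (hinj _ hbq (left_mem_seg q u) this ▸ hb)
  have hes : e = e % d + d * (e / d) := (Nat.mod_add_div e d).symm
  -- A coincidence of images at times i and e + i makes f^e preserve the germ at q. So does the
  -- remainder of e modulo d, which minimality of d forces to be 0.
  have hr : e % d = 0 := by
    by_contra hr
    have h1 : f^[e % d] q = q := by
      have := heq
      rw [hes, iterate_add_apply, iterate_mul_fixed hdq] at this
      simpa using this
    have h2 : f^[e % d] (f^[d * (e / d)] (f^[d * i] b)) ∈ seg q u := by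
      rw [← iterate_add_apply, ← hes, hshift i le_rfl]
      exact hmaps i haq
    have h3 : f^[d * (e / d)] (f^[d * i] b) = f^[d * (e / d + i)] b := by
      rw [← iterate_add_apply, Nat.mul_add]
    rw [h3] at h2
    have := hmin _ (Nat.pos_of_ne_zero hr) h1 _ (hmaps _ hbq) (hne _) h2
    exact absurd (Nat.mod_lt e hd) (not_lt.2 this)
  obtain ⟨s, rfl⟩ : ∃ s, e = d * (s + 1) := by
    obtain ⟨s, rfl⟩ := Nat.dvd_of_mod_eq_zero hr
    refine ⟨s - 1, ?_⟩
    have : 0 < s := Nat.pos_of_mul_pos_left he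
    rw [Nat.sub_add_cancel this]
  have hab' : a = f^[d * (s + 1)] b := by
    refine hinj (d * i) haq (hmaps _ hbq) ?_
    rw [← hshift i le_rfl, ← iterate_add_apply, ← iterate_add_apply, Nat.add_comm]
  have hat : a ∈ seg q t := by
    have h1 : f^[d] b ∈ seg q t := hinj.mapsTo_seg hf hdq (right_mem_seg q u) hbq
    have h2 : f^[d] t ∈ seg q t := hinj.mapsTo_seg hf hdq (right_mem_seg q u) hdu
    have h3 := (hinj.mono (seg_subset_left hdu)).mapsTo_mul hf hdq h2 s h1
    rwa [← iterate_add_apply, ← Nat.mul_succ, ← hab'] at h3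
  have h1 : t ∈ seg u a := by rw [seg_comm]; exact mem_seg_right hdu hat
  have h2 : a ∈ seg u w := by rw [seg_comm]; exact ha
  have h3 : w ∈ seg u t := by rw [seg_comm]; exact hw
  exact hwt (seg_antisymm h3 (mem_seg_trans h2 h1))

/-- The period k need not be minimal, so it is replaced by the least d for which f^d preserves the
germ of the arc at q, on the arc up to a late iterate u of x. There f^d must attract as well, since
its powers share iterates with those of f^k. -/
theorem not_attracting (hf : Continuous f) (hwand : NoWanderingContinua f) {q x : X}
    (hinj : IteratesInjOn f (seg q x)) (hqx : q ≠ x) {k : ℕ} (hk : 0 < k) (hkq : f^[k] q = q)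
    (hkx : f^[k] x ∈ seg q x) (hlim : Tendsto (fun n => f^[k * n] x) atTop (𝓝 q)) : False := by
  classical
  have hex : ∃ e, 0 < e ∧ f^[e] q = q ∧ ∃ v ∈ seg q x, v ≠ q ∧ f^[e] v ∈ seg q x :=
    ⟨k, hk, hkq, x, right_mem_seg q x, hqx.symm, hkx⟩
  obtain ⟨hd, hdq, v, hv, hvq, hdv⟩ := Nat.find_spec hex
  set d := Nat.find hex with hd_def
  have hev : ∀ᶠ n in atTop, f^[k * n] x ∉ {y | v ∈ seg q y} := by
    refine hlim.eventually ((isClosed_setOf_le q v).isOpen_compl.mem_nhds ?_)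
    intro (h : v ∈ seg q q)
    rw [seg_self] at h
    exact hvq h
  obtain ⟨n, hn⟩ := hev.exists
  set u := f^[k * n] x with hu
  have hux : u ∈ seg q x := hinj.mapsTo_mul hf hkq hkx n (right_mem_seg q x)
  have huv : u ∈ seg q v := (seg_linear hux hv).resolve_right hn
  have huq : u ≠ q := fun h => by
    refine hqx (hinj (k * n) (left_mem_seg q x) (right_mem_seg q x) ?_)
    rw [iterate_mul_fixed hkq, ← hu, h]
  have hinju := hinj.mono (seg_subset_left hux)
  have hku : f^[k] u ∈ seg q u := by
    have := hinj.mapsTo_seg hf (iterate_mul_fixed hkq n) (right_mem_seg q x) hkx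
    rwa [← iterate_add_apply, Nat.add_comm, iterate_add_apply] at this
  have hlimu : Tendsto (fun m => f^[k * m] u) atTop (𝓝 q) := by
    have := hlim.comp (tendsto_add_atTop_nat n)
    refine this.congr fun m => ?_
    rw [comp_apply, hu, ← iterate_add_apply, Nat.mul_add]
  have hdu' : f^[d] u ∈ seg q x := mem_seg_trans hdv (hinj.mapsTo_seg hf hdq hv huv)
  have hnot : u ∉ seg q (f^[d] u) := by
    intro h
    have hj : ∀ j, u ∈ seg q (f^[d * j] u) := by
      intro j
      induction j with
      | zero => exact right_mem_seg _ _
      | succ j ih =>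
        refine mem_seg_trans ?_ ih
        have := hinj.mapsTo_seg hf (iterate_mul_fixed hdq j) hdu' h
        rwa [← iterate_add_apply] at this
    have h1 : ∀ m, f^[k * (d * m)] u = u := fun m => by
      refine seg_antisymm (hinju.mapsTo_mul hf hkq hku _ (right_mem_seg q u)) ?_
      have := hj (k * m)
      rwa [show d * (k * m) = k * (d * m) by ring] at this
    have h2 := hlimu.comp (tendsto_id.const_mul_atTop' hd : Tendsto (fun m => d * m) atTop atTop)
    exact huq (tendsto_nhds_unique (tendsto_const_nhds.congr fun m => (h1 m).symm) h2)
  have hdu : f^[d] u ∈ seg q u := (seg_linear hdu' hux).resolve_right hnot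
  have hdne : f^[d] u ≠ u := fun h => hnot (by rw [h]; exact right_mem_seg _ _)
  refine not_attracting_of_minimal hf hwand hinju hd hdq hdu hdne ?_ ?_
  · obtain ⟨s, hs, -⟩ := exists_tendsto_of_antitone (t := q) (z := fun n => f^[d * n] u) fun n => by
      have := hinju.mapsTo_seg hf (iterate_mul_fixed hdq n) (right_mem_seg q u) hdu
      rwa [← iterate_add_apply f (d * n) d u] at this
    have h1 := hs.comp (tendsto_id.const_mul_atTop' hk : Tendsto (fun m => k * m) atTop atTop)
    have h2 := hlimu.comp (tendsto_id.const_mul_atTop' hd : Tendsto (fun m => d * m) atTop atTop)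
    have : s = q := by
      refine tendsto_nhds_unique h1 (h2.congr fun m => ?_)
      simp only [comp_apply]
      rw [show d * (k * m) = k * (d * m) by ring]
    rwa [this] at hs
  · intro e he heq v hv hvq hev
    exact Nat.find_min' hex ⟨he, heq, v, seg_subset_left hux hv, hvq, seg_subset_left hux hev⟩

/-- A monotone orbit converges to a fixed point s of f^k, and then `seg s u` is attracted to s. -/
theorem not_monotone_orbit (hf : Continuous f) (hwand : NoWanderingContinua f) {S : Set X}
    (hinj : IteratesInjOn f S) {r u : X} (hru : seg r u ⊆ S) {k : ℕ} (hk : 0 < k)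
    (hne : f^[k] u ≠ u) (hz : ∀ n, (f^[k])^[n + 1] u ∈ seg r ((f^[k])^[n] u)) : False := by
  obtain ⟨s, hs, hsm⟩ := exists_tendsto_of_antitone hz
  have hfix : f^[k] s = s := by
    have h1 := ((hf.iterate k).tendsto s).comp hs
    refine tendsto_nhds_unique h1 ((hs.comp (tendsto_add_atTop_nat 1)).congr fun n => ?_)
    exact iterate_succ_apply' _ _ _
  have hsu : s ∈ seg r u := hsm 0
  refine not_attracting hf hwand (hinj.mono ((seg_subset_right hsu).trans hru)) ?_ hk hfix ?_ ?_
  · rintro rfl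
    exact hne hfix
  · exact mem_seg_right (hz 0) (hsm 1)
  · refine hs.congr fun n => ?_
    rw [iterate_mul]

/-- An arc on which all iterates are injective cannot be mapped into itself by an iterate fixing
one of its endpoints. -/
theorem not_invariant (hf : Continuous f) (hwand : NoWanderingContinua f)
    (hid : ¬ HasIdentityReturn f) {q y : X} (hinj : IteratesInjOn f (seg q y)) (hqy : q ≠ y)
    {k : ℕ} (hk : 0 < k) (hq : f^[k] q = q) (hy : f^[k] y ∈ seg q y) : False := by
  have hmaps := hinj.mapsTo hf hq hy
  obtain ⟨u, hu, hne⟩ : ∃ u ∈ seg q y, f^[k] u ≠ u := by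
    by_contra! h
    exact hid ⟨seg q y, isNondegContinuum_seg hqy, k, hk, h⟩
  have hun : ∀ n, (f^[k])^[n] u ∈ seg q y := fun n => hmaps.iterate n hu
  have hqn : ∀ n, (f^[k])^[n] q = q := fun n => iterate_fixed hq n
  have happ : ∀ n, ∀ v ∈ seg q y, ∀ z ∈ seg q v, (f^[k])^[n] z ∈ seg q ((f^[k])^[n] v) := by
    intro n v hv z hz
    rw [← iterate_mul]
    exact hinj.mapsTo_seg hf (iterate_mul_fixed hq n) hv hz
  rcases seg_linear (hmaps hu) hu with h | h
  · refine not_monotone_orbit hf hwand hinj (seg_subset_left hu) hk hne fun n => ?_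
    rw [iterate_succ_apply]
    exact happ n u hu _ h
  · refine not_monotone_orbit hf hwand hinj (r := y) (u := u) ?_ hk hne fun n => ?_
    · rw [seg_comm]; exact seg_subset_right hu
    · have h1 := happ n _ (hmaps hu) _ h
      rw [← iterate_succ_apply] at h1
      rw [seg_comm]
      exact mem_seg_right (hun (n + 1)) h1

/-- Write the common point z as f^e y. Either f^e y ≤ y and `seg q y` is invariant, or the points
f^(en) y increase to a fixed point s. In the latter case iterates are one-to-one on every proper
initial piece of `seg q s`, hence on all of it. -/
theorem not_germ_return (hf : Continuous f) (hwand : NoWanderingContinua f)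
    (hid : ¬ HasIdentityReturn f) {q x z : X} (hinj : IteratesInjOn f (seg q x)) {e : ℕ}
    (he : 0 < e) (heq : f^[e] q = q) (hzq : z ≠ q) (hz : z ∈ seg q x)
    (hz' : z ∈ seg q (f^[e] x)) : False := by
  have him := hinj.image_seg hf e
  rw [heq] at him
  rw [← him] at hz'
  obtain ⟨y, hy, rfl⟩ := hz'
  have hyq : y ≠ q := fun h => hzq (by rw [h, heq])
  rcases seg_linear hz hy with h | h
  · exact not_invariant hf hwand hid (hinj.mono (seg_subset_left hy)) hyq.symm he heq h
  · have hmono : ∀ n, f^[e * n] y ∈ seg q (f^[e * (n + 1)] y) := by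
      intro n
      have := hinj.mapsTo_seg hf (iterate_mul_fixed heq n) hz h
      rwa [← iterate_add_apply] at this
    obtain ⟨s, hs, hsu⟩ := exists_tendsto_of_monotone (q := q) (x := fun n => f^[e * n] y) hmono
    have hfix : f^[e] s = s := by
      have h1 := ((hf.iterate e).tendsto s).comp hs
      refine tendsto_nhds_unique h1 ((hs.comp (tendsto_add_atTop_nat 1)).congr fun n => ?_)
      simp only [comp_apply]
      rw [← iterate_add_apply, Nat.mul_succ, Nat.add_comm]
    have hys : y ∈ seg q s := hsu 0
    have hinjs : IteratesInjOn f (seg q s) := by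
      intro m
      refine injOn_seg_of_injOn_initial (hf.iterate m) fun v hv hvs => ?_
      obtain ⟨n, hn⟩ := (hs.eventually ((isOpen_setOf_lt q v).mem_nhds ⟨hv, hvs.symm⟩)).exists
      have h1 := (hinj.mono (seg_subset_left hy)).seg_iterate hf (e * n)
      rw [iterate_mul_fixed heq] at h1
      exact (h1 m).mono (seg_subset_left hn.1)
    refine not_invariant hf hwand hid hinjs ?_ he heq (by rw [hfix]; exact right_mem_seg _ _)
    rintro rfl
    rw [seg_self] at hys
    exact hyq hys

/-- An arc on which all iterates are injective has no periodic endpoint. -/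
theorem not_periodic_endpoint (hf : Continuous f) (hwand : NoWanderingContinua f)
    (hid : ¬ HasIdentityReturn f) {q x : X} (hinj : IteratesInjOn f (seg q x)) (hqx : q ≠ x) {N : ℕ}
    (hN : 0 < N) (hNq : f^[N] q = q) : False := by
  -- By `not_germ_return`, image arcs issuing from the same orbit point meet only there.
  have hsep' : ∀ i j, i < j → f^[i] q = f^[j] q → ∀ z, z ∈ seg (f^[i] q) (f^[i] x) →
      z ∈ seg (f^[j] q) (f^[j] x) → z = f^[i] q := by
    intro i j hij hq z hz hz'
    by_contra hne
    obtain ⟨e, rfl⟩ : ∃ e, j = e + i := ⟨j - i, by omega⟩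
    rw [← hq, iterate_add_apply f e i x] at hz'
    refine not_germ_return hf hwand hid (hinj.seg_iterate hf i) (e := e) (by omega) ?_ hne hz hz'
    rw [← iterate_add_apply, hq]
  have hsep : ∀ i j, i ≠ j → f^[i] q = f^[j] q → ∀ z, z ∈ seg (f^[i] q) (f^[i] x) →
      z ∈ seg (f^[j] q) (f^[j] x) → z = f^[i] q := by
    intro i j hij hq z hz hz'
    rcases lt_or_gt_of_ne hij with h | h
    · exact hsep' i j h hq z hz hz'
    · rw [hq]; exact hsep' j i h hq.symm z hz' hz
  let Q : Set X := range fun i => f^[i] q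
  have hQ : Q.Finite := by
    refine ((Finset.range N).finite_toSet.image fun i => f^[i] q).subset ?_
    rintro _ ⟨i, rfl⟩
    refine ⟨i % N, by simpa using Nat.mod_lt i hN, ?_⟩
    have : i = i % N + N * (i / N) := (Nat.mod_add_div i N).symm
    dsimp only
    conv_rhs => rw [this, iterate_add_apply, iterate_mul_fixed hNq]
  -- Index i is bad if its image arc heads toward another orbit point. Arcs at one base point
  -- heading toward the same orbit point would overlap, so each pair of orbit points accounts for at
  -- most one bad index.
  have hbad : {i | ∃ m, f^[m] q ≠ f^[i] q ∧ f^[i] q ∉ seg (f^[m] q) (f^[i] x)}.Finite := by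
    have hch : ∀ i, ∃ m, i ∈ {i | ∃ m, f^[m] q ≠ f^[i] q ∧ f^[i] q ∉ seg (f^[m] q) (f^[i] x)} →
        f^[i] q ∉ seg (f^[m] q) (f^[i] x) := by
      intro i
      by_cases h : ∃ m, f^[m] q ≠ f^[i] q ∧ f^[i] q ∉ seg (f^[m] q) (f^[i] x)
      · obtain ⟨m, -, hm⟩ := h
        exact ⟨m, fun _ => hm⟩
      · exact ⟨0, fun h' => absurd h' h⟩
    choose m hm using hch
    refine Finite.of_injOn (f := fun i => (f^[i] q, f^[m i] q)) (t := Q ×ˢ Q)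
      (fun i _ => ⟨⟨i, rfl⟩, ⟨m i, rfl⟩⟩) ?_ (hQ.prod hQ)
    intro i hi j hj hij
    by_contra hne
    obtain ⟨e1, e2⟩ := Prod.mk.inj hij
    have hi' := hm i hi
    have hj' := hm j hj
    rw [← e1, ← e2] at hj'
    have hmem : f^[i] q ∈ seg (f^[i] x) (f^[j] x) := by
      by_contra hnot
      obtain ⟨v, hv, hv1, hv2⟩ := exists_common_of_notMem_seg hnot
      exact hv (hsep i j hne e1 v hv1 (e1 ▸ hv2))
    rcases seg_subset_union _ _ (f^[m i] q) hmem with h | h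
    · rw [seg_comm] at h
      exact hi' h
    · exact hj' h
  obtain ⟨B, hB⟩ := hbad.bddAbove
  have hgood : ∀ i, B < i → ∀ m, f^[m] q ≠ f^[i] q → f^[i] q ∈ seg (f^[m] q) (f^[i] x) := by
    intro i hi m hm
    by_contra h
    exact absurd (hB ⟨m, hm, h⟩) (not_le.2 hi)
  have hqxB : f^[B + 1] q ≠ f^[B + 1] x := fun h =>
    hqx (hinj _ (left_mem_seg q x) (right_mem_seg q x) h)
  obtain ⟨w, hw, hwq, hwx⟩ := exists_mem_seg_between hqxB
  have hKsub := seg_subset_right hw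
  have hqK : f^[B + 1] q ∉ seg w (f^[B + 1] x) := by
    intro h
    rw [seg_comm] at h hw
    exact hwq (seg_antisymm hw h)
  have hinjB := hinj.seg_iterate hf (B + 1)
  -- Past B all image arcs point outward. If two with distinct base points met at z, each base point
  -- would lie between z and the other.
  refine hwand _ (isNondegContinuum_seg hwx) (isWandering_of_lt ?_)
  intro i j hij a ha b hb hab
  have hza := hinjB.map_mem hf i (hKsub ha)
  have hzb := hinjB.map_mem hf j (hKsub hb)
  rw [← hab] at hzb
  have hzne : f^[i] a ≠ f^[i] (f^[B + 1] q) := fun h =>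
    hqK (hinjB i (hKsub ha) (left_mem_seg _ _) h ▸ ha)
  simp only [← iterate_add_apply] at hza hzb hzne
  by_cases hq : f^[i + (B + 1)] q = f^[j + (B + 1)] q
  · exact hzne (hsep _ _ (by omega) hq _ hza hzb)
  · have h1 := hgood (i + (B + 1)) (by omega) (j + (B + 1)) (Ne.symm hq)
    have h2 := hgood (j + (B + 1)) (by omega) (i + (B + 1)) hq
    rw [seg_comm] at h1 h2 hza hzb
    exact hq (seg_antisymm (mem_seg_right h1 hza) (mem_seg_right h2 hzb))

theorem not_periodic_of_iteratesInjOn (hf : Continuous f) (hwand : NoWanderingContinua f)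
    (hid : ¬ HasIdentityReturn f) {u v q : X} (hinj : IteratesInjOn f (seg u v)) (huv : u ≠ v)
    (hq : q ∈ seg u v) {N : ℕ} (hN : 0 < N) (hNq : f^[N] q = q) : False := by
  by_cases h : q = u
  · subst h
    exact not_periodic_endpoint hf hwand hid hinj huv hN hNq
  · refine not_periodic_endpoint hf hwand hid (hinj.mono ?_) h hN hNq
    exact seg_subset_seg hq (left_mem_seg u v)

end HomArcs

/-! ### Critical points, fixed cutpoints and condensity. -/

section CriticalPoints

variable {X : Type*} {f : X → X}

theorem iteratesInjOn_of_mapsTo {S : Set X} (h : InjOn f S) (hS : MapsTo f S S) :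
    IteratesInjOn f S := fun n => h.iterate hS n

theorem IteratesInjOn.of_iterate {S : Set X} {k : ℕ} (hk : 0 < k)
    (h : IteratesInjOn f^[k] S) : IteratesInjOn f S := by
  intro m
  have h1 := h m
  rw [← iterate_mul] at h1
  obtain ⟨l, hl⟩ := Nat.exists_eq_add_of_le' (Nat.le_mul_of_pos_left m hk)
  rw [hl, iterate_add] at h1
  exact h1.of_comp

variable [TopologicalSpace X]

/-- A critical point of f^(k+1) is critical for f or is mapped by f to a critical point of f^k. -/
theorem finite_criticalPoints_iterate (hf : Continuous f) (hfib : ∀ y : X, (f ⁻¹' {y}).Finite)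
    (hfin : {x | IsCriticalPoint f x}.Finite) (k : ℕ) : {x | IsCriticalPoint f^[k] x}.Finite := by
  induction k with
  | zero =>
    refine Set.finite_empty.subset fun x hx => hx univ univ_mem ?_
    exact injOn_id _
  | succ k ih =>
    refine (hfin.union (ih.preimage' fun b _ => hfib b)).subset fun x hx => ?_
    by_contra hnot
    simp only [mem_union, mem_ofPred_eq, mem_preimage, not_or, IsCriticalPoint] at hnot
    push Not at hnot
    obtain ⟨⟨U, hU, hUi⟩, V, hV, hVi⟩ := hnot
    refine hx (U ∩ f ⁻¹' V) (inter_mem hU (hf.continuousAt.preimage_mem_nhds hV)) ?_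
    rw [iterate_succ]
    exact hVi.comp (hUi.mono inter_subset_left) fun z hz => hz.2

variable [hX : Fact (IsDendrite X)]

/-- a and b are the fixed points nearest to z on either side. -/
theorem exists_gap {u v z : X} (hz : z ∈ seg u v) (hu : f u = u) (hv : f v = v)
    (hf : Continuous f) (hne : f z ≠ z) :
    ∃ a b, a ≠ b ∧ f a = a ∧ f b = b ∧ ∀ w ∈ seg a b, w ≠ a → w ≠ b → f w ≠ w := by
  have huv : u ≠ v := by
    rintro rfl
    rw [seg_self] at hz
    exact hne (by rw [hz, hu])
  obtain ⟨α, a, b, hα, rfl, rfl, e⟩ := exists_arcParam huv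
  rw [← e] at hz
  obtain ⟨τ, hτ, rfl⟩ := hz
  have hab := hα.1
  have hF : IsClosed {w | f w = w} := isClosed_eq hf continuous_id
  have hA : IsCompact (Icc a b ∩ α ⁻¹' {w | f w = w}) :=
    isCompact_Icc.of_isClosed_subset (hα.2.1.preimage_isClosed_of_isClosed isClosed_Icc hF)
      inter_subset_left
  obtain ⟨s₀, ⟨⟨hs₀I, hs₀F⟩, hs₀τ⟩, hs₀m⟩ :=
    (hA.inter_right (isClosed_Iic (a := τ))).exists_isGreatest ⟨a, ⟨⟨le_rfl, hab.le⟩, hu⟩, hτ.1⟩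
  obtain ⟨s₁, ⟨⟨hs₁I, hs₁F⟩, hs₁τ⟩, hs₁m⟩ :=
    (hA.inter_right (isClosed_Ici (a := τ))).exists_isLeast ⟨b, ⟨⟨hab.le, le_rfl⟩, hv⟩, hτ.2⟩
  have h₀ : s₀ < τ := lt_of_le_of_ne hs₀τ fun h => hne (h ▸ hs₀F)
  have h₁ : τ < s₁ := lt_of_le_of_ne hs₁τ fun h => hne (h ▸ hs₁F)
  refine ⟨α s₀, α s₁, fun h => (h₀.trans h₁).ne (hα.2.2 hs₀I hs₁I h), hs₀F, hs₁F, ?_⟩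
  rw [hα.seg_eq hs₀I.1 (h₀.trans h₁).le hs₁I.2]
  rintro _ ⟨s, hs, rfl⟩ hsa hsb hfix
  have hsA : s ∈ Icc a b ∩ α ⁻¹' {w | f w = w} :=
    ⟨⟨hs₀I.1.trans hs.1, hs.2.trans hs₁I.2⟩, hfix⟩
  rcases le_total s τ with h | h
  · exact hsa (by rw [le_antisymm (hs₀m ⟨hsA, h⟩) hs.1])
  · exact hsb (by rw [le_antisymm hs.2 (hs₁m ⟨hsA, h⟩)])

theorem exists_critical_cutpoint_not_fixed [Nontrivial X] (hf : Continuous f)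
    (hwand : NoWanderingContinua f) (hid : ¬ HasIdentityReturn f) :
    ∃ x : X, IsCriticalPoint f x ∧ IsCutpoint x ∧ f x ≠ x := by
  by_contra! hcrit
  have hinj : ∀ x y : X, (∀ z ∈ seg x y, z ≠ x → z ≠ y → f z ≠ z) → InjOn f (seg x y) :=
    fun x y h => injOn_seg_of_not_critical hf fun z hz hzx hzy hc =>
      h z hz hzx hzy (hcrit z hc (isCutpoint_of_mem_seg hz hzx hzy))
  obtain ⟨p, -⟩ := exists_pair_ne X
  obtain ⟨a, ha, -⟩ := exists_fixed_above hf (left_mem_seg p (f p))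
  have huniq : ∀ b, f b = b → b = a := by
    intro b hb
    by_contra hba
    obtain ⟨z, hz, hzne⟩ : ∃ z ∈ seg a b, f z ≠ z := by
      by_contra! h
      exact hid ⟨seg a b, isNondegContinuum_seg (Ne.symm hba), 1, one_pos, h⟩
    -- Between neighbouring fixed points f is one-to-one and maps the arc onto itself, so all
    -- iterates are one-to-one there.
    obtain ⟨u, v, huv, hu, hv, hgap⟩ := exists_gap hz ha hb hf hzne
    have hi := hinj u v hgap
    refine not_periodic_endpoint hf hwand hid (iteratesInjOn_of_mapsTo hi ?_) huv one_pos hu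
    intro w hw
    have := map_mem_seg hf hi hw
    rwa [hu, hv] at this
  obtain ⟨x, hx⟩ := exists_ne a
  have hall : ∀ y, InjOn f (seg a y) := fun y => hinj a y fun z _ hza _ hz => hza (huniq z hz)
  have hiter : IteratesInjOn f (seg a x) := by
    intro n
    induction n with
    | zero => exact injOn_id _
    | succ n ih =>
      have him := image_seg (hf.iterate n) ih
      rw [iterate_fixed ha] at him
      rw [iterate_succ']
      exact (hall (f^[n] x)).comp ih (him ▸ mapsTo_image _ _)
  exact not_periodic_endpoint hf hwand hid hiter hx.symm one_pos ha

/-- An iterate with finitely many critical points has a fixed point that cuts a given invariant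
subcontinuum. -/
theorem exists_fixed_between (hf : Continuous f) (hwand : NoWanderingContinua f)
    (hid : ¬ HasIdentityReturn f) {k : ℕ} (hk : 0 < k)
    (hfin : {x | IsCriticalPoint f^[k] x}.Finite) {Y : Set X} (hYc : IsClosed Y)
    (hY : IsPreconnected Y) (hYn : Y.Nontrivial) (hmaps : MapsTo f^[k] Y Y) :
    ∃ e, f^[k] e = e ∧ ∃ u ∈ Y, ∃ v ∈ Y, e ∈ seg u v ∧ e ≠ u ∧ e ≠ v := by
  by_contra! H
  have hg := hf.iterate k
  obtain ⟨p, hpY, hp⟩ : ∃ p ∈ Y, f^[k] p ≠ p := by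
    by_contra! h
    exact hid ⟨Y, ⟨hYc.isCompact, ⟨hYn.nonempty, hY⟩, hYn⟩, k, hk, h⟩
  -- Fixed points are left out of S, so a maximal element could be pushed up further. The work lies
  -- in showing that the supremum e of a chain in S is not fixed when no fixed point cuts Y.
  have hex := exists_maximal_of_chain_closed p
    (S := {x | x ∈ Y ∧ x ∈ seg p (f^[k] x) ∧ f^[k] x ≠ x}) ⟨p, hpY, left_mem_seg _ _, hp⟩ ?_
  · obtain ⟨m, ⟨hmY, hm, hmne⟩, hmax⟩ := hex
    obtain ⟨y, hym, hy, hmy, hpy, hyne⟩ := exists_push_up hg hm (right_mem_seg _ _) hmne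
    exact hym (hmax y ⟨seg_subset hY hmY (hmaps hmY) hy, hpy, hyne⟩ hmy)
  · rintro c hc ⟨x₀, hx₀⟩ e he1 he2 he3
    have heY : e ∈ Y := closure_minimal (fun y hy => (hc hy.1).1) hYc (he1 x₀ hx₀)
    refine ⟨heY, sup_le_map hg (fun x hx => (hc hx).2.1) he1 he3, fun hfix => ?_⟩
    have hec : ∀ y ∈ c, y ≠ e := by
      rintro y hy rfl
      exact (hc hy).2.2 hfix
    have hW : ({x | IsCriticalPoint f^[k] x} \ {e})ᶜ ∈ 𝓝 e :=
      (hfin.subset sdiff_subset).isClosed.isOpen_compl.mem_nhds fun h => h.2 rfl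
    obtain ⟨x, hxW, hxc, -⟩ := mem_closure_iff_nhds.1 (he1 x₀ hx₀) _ (eventually_seg_subset hW)
    have hxe := hec x hxc
    have hxY := (hc hxc).1
    have hi : InjOn f^[k] (seg e x) := injOn_seg_of_not_critical hg fun z hz hze _ hzc =>
      hxW hz ⟨hzc, hze⟩
    -- Near a fixed e, f^k is one-to-one on `seg e x`. As e does not cut Y, x and its image lie on
    -- the same side of e; chain points z near e move toward e, so `seg e z` becomes invariant.
    have hnot : e ∉ seg x (f^[k] x) := by
      intro h
      have h1 := H e hfix x hxY _ (hmaps hxY) h hxe.symm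
      exact hxe (hi (left_mem_seg _ _) (right_mem_seg _ _) (hfix.trans h1)).symm
    obtain ⟨v, hve, hv1, hv2⟩ := exists_common_of_notMem_seg hnot
    have him := image_seg hg hi
    rw [hfix] at him
    rw [← him] at hv2
    obtain ⟨y, hy, rfl⟩ := hv2
    have hye : y ≠ e := fun h => hve (by rw [h, hfix])
    have hxp : seg e x ⊆ seg p e := by
      rw [seg_comm]
      exact seg_subset_right (he2 x hxc)
    obtain ⟨z, hzW, hzc, -⟩ := mem_closure_iff_nhds.1 (he1 x hxc) _
      ((isOpen_setOf_lt p y).mem_nhds ⟨hxp hy, hye.symm⟩)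
    have hze := hec z hzc
    have hzy : z ∈ seg e y := by
      rw [seg_comm]
      exact mem_seg_right (he2 z hzc) hzW.1
    have hiz : InjOn f^[k] (seg e z) := hi.mono (seg_subset_left (seg_subset_left hy hzy))
    have hgz : f^[k] z ∈ seg p e := by
      have := map_mem_seg hg (hi.mono (seg_subset_left hy)) hzy
      rw [hfix] at this
      exact hxp (seg_subset_left hv1 this)
    have hgz' : f^[k] z ∈ seg e z := by
      rw [seg_comm]
      exact mem_seg_right hgz (hc hzc).2.1
    have hmz : MapsTo f^[k] (seg e z) (seg e z) := by
      intro w hw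
      have := map_mem_seg hg hiz hw
      rw [hfix] at this
      exact seg_subset_left hgz' this
    exact not_periodic_endpoint hf hwand hid ((iteratesInjOn_of_mapsTo hiz hmz).of_iterate hk)
      hze.symm hk hfix

/-- Since the arc does not wander, its images at times m and k + m meet. The sets f^(ki) of the m-th
image then chain up to a connected invariant set. -/
theorem not_iteratesInjOn_seg (hf : Continuous f) (hwand : NoWanderingContinua f)
    (hid : ¬ HasIdentityReturn f) (hfib : ∀ y : X, (f ⁻¹' {y}).Finite)
    (hfin : {x | IsCriticalPoint f x}.Finite) {u v : X} (huv : u ≠ v) :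
    ¬ IteratesInjOn f (seg u v) := by
  intro hinj
  obtain ⟨m, n, hmn, hint⟩ : ∃ m n, m < n ∧ ¬ Disjoint (f^[m] '' seg u v) (f^[n] '' seg u v) := by
    by_contra! h
    refine hwand _ (isNondegContinuum_seg huv) fun m n hmn => ?_
    rcases lt_or_gt_of_ne hmn with h' | h'
    · exact h m n h'
    · exact (h n m h').symm
  obtain ⟨k, rfl⟩ : ∃ k, n = k + m := ⟨n - m, by omega⟩
  have hk : 0 < k := by omega
  rw [iterate_add, image_comp, hinj.image_seg hf m, not_disjoint_iff] at hint
  have hinjJ := hinj.seg_iterate hf m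
  have hne : f^[m] u ≠ f^[m] v := fun h =>
    huv (hinj m (left_mem_seg u v) (right_mem_seg u v) h)
  set u' := f^[m] u
  set v' := f^[m] v
  let s : ℕ → Set X := fun i => f^[k * i] '' seg u' v'
  have hT : IsPreconnected (⋃ i, s i) := by
    refine IsPreconnected.iUnion_of_chain
      (fun i => (isPreconnected_seg u' v').image _ (hf.iterate _).continuousOn) fun i => ?_
    obtain ⟨x, hx1, y, hy, rfl⟩ := hint
    refine ⟨f^[k * i] (f^[k] y), ⟨_, hx1, rfl⟩, y, hy, ?_⟩
    rw [← iterate_add_apply, Order.succ_eq_add_one, Nat.mul_add_one]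
  have hmaps : MapsTo f^[k] (⋃ i, s i) (⋃ i, s i) := by
    intro x hx
    obtain ⟨i, y, hy, rfl⟩ := mem_iUnion.1 hx
    refine mem_iUnion.2 ⟨i + 1, y, hy, ?_⟩
    rw [← iterate_add_apply, Nat.mul_succ, Nat.add_comm]
  have h0 : seg u' v' ⊆ ⋃ i, s i := fun x hx => mem_iUnion.2 ⟨0, x, hx, rfl⟩
  obtain ⟨e, he, a, ha, b, hb, hab, hea, heb⟩ := exists_fixed_between hf hwand hid hk
    (finite_criticalPoints_iterate hf hfib hfin k) isClosed_closure hT.closure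
    ⟨u', subset_closure (h0 (left_mem_seg _ _)), v', subset_closure (h0 (right_mem_seg _ _)), hne⟩
    (hmaps.closure (hf.iterate k))
  -- The fixed point e cuts only the closure a priori. Adding just a and b to the union keeps it
  -- connected, so e, lying between them, is in the union itself.
  have hC : IsPreconnected ((⋃ i, s i) ∪ {a, b}) := by
    refine hT.subset_closure subset_union_left (union_subset subset_closure ?_)
    rintro x (rfl | rfl) <;> assumption
  have heT : e ∈ ⋃ i, s i := by
    rcases seg_subset hC (Or.inr (Or.inl rfl)) (Or.inr (Or.inr rfl)) hab with h | h | h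
    · exact h
    · exact absurd h hea
    · exact absurd h heb
  obtain ⟨i, hi⟩ := mem_iUnion.1 heT
  change e ∈ f^[k * i] '' seg u' v' at hi
  rw [hinjJ.image_seg hf] at hi
  refine not_periodic_of_iteratesInjOn hf hwand hid (hinjJ.seg_iterate hf (k * i)) ?_ hi hk he
  exact fun h => hne (hinjJ _ (left_mem_seg _ _) (right_mem_seg _ _) h)

theorem IsArc.exists_eq_seg {I : Set X} (hI : IsArc I) : ∃ u v, u ≠ v ∧ I = seg u v := by
  obtain ⟨e⟩ := hI
  have hα : IsArcParam (fun t => (e (projIcc 0 1 zero_le_one t) : X)) 0 1 := by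
    refine ⟨zero_lt_one, ?_, ?_⟩
    · exact (continuous_subtype_val.comp (e.continuous.comp continuous_projIcc)).continuousOn
    · intro s hs t ht h
      have := e.injective (Subtype.val_injective h)
      rw [projIcc_of_mem _ hs, projIcc_of_mem _ ht] at this
      exact congrArg Subtype.val this
  refine ⟨_, _, fun h => zero_ne_one (hα.2.2 (by simp) (by simp) h), ?_⟩
  rw [← hα.image_eq]
  ext x
  constructor
  · intro hx
    obtain ⟨t, ht⟩ := e.surjective ⟨x, hx⟩
    refine ⟨t, t.2, ?_⟩
    dsimp only
    rw [projIcc_val, ht]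
  · rintro ⟨t, -, rfl⟩
    exact Subtype.coe_prop _

theorem mem_openArc {x y z : X} (hz : z ∈ seg x y) (hzx : z ≠ x) (hzy : z ≠ y) :
    z ∈ openArc x y := by
  have hxy : x ≠ y := by
    rintro rfl
    rw [seg_self] at hz
    exact hzx hz
  obtain ⟨α, a, b, hα, rfl, rfl, e⟩ := exists_arcParam hxy
  have hab : 0 < b - a := sub_pos.2 hα.1
  have hmem : ∀ t : unitInterval, a + (b - a) * t ∈ Icc a b := fun t => by
    constructor <;> nlinarith [t.2.1, t.2.2]
  let β : unitInterval → X := fun t => α (a + (b - a) * t)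
  have hβc : Continuous β := hα.2.1.comp_continuous (by fun_prop) hmem
  have hβi : Injective β := by
    intro s t h
    have := hα.2.2 (hmem s) (hmem t) h
    have := mul_left_cancel₀ hab.ne' (add_left_cancel this)
    exact Subtype.ext this
  refine ⟨hzx, hzy, range β, ⟨(hβc.isClosedEmbedding hβi).isEmbedding.toHomeomorph, ?_, ?_⟩, ?_⟩
  · change α (a + (b - a) * (0 : ℝ)) = α a
    simp
  · change α (a + (b - a) * (1 : ℝ)) = α b
    simp
  · rw [← e] at hz
    obtain ⟨s, hs, rfl⟩ := hz
    refine ⟨⟨(s - a) / (b - a), div_nonneg (by linarith [hs.1]) hab.le,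
      (div_le_one hab).2 (by linarith [hs.2])⟩, ?_⟩
    change α (a + (b - a) * ((s - a) / (b - a))) = α s
    congr 1
    field_simp
    ring

theorem isCondense_criticalPreimages (hf : Continuous f) (hwand : NoWanderingContinua f)
    (hid : ¬ HasIdentityReturn f) (hfib : ∀ y : X, (f ⁻¹' {y}).Finite)
    (hfin : {x | IsCriticalPoint f x}.Finite) : IsCondense (criticalPreimages f) := by
  rintro K ⟨-, hKc, hKn⟩ x hx
  by_contra hnot
  -- `criticalPreimages` starts at time 1, so critical points of f itself are avoided separately.
  -- Only x may remain critical, which is harmless at an endpoint.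
  have hU : (closure (criticalPreimages f ∩ K))ᶜ ∩ ({x | IsCriticalPoint f x} \ {x})ᶜ ∈ 𝓝 x :=
    inter_mem (isClosed_closure.isOpen_compl.mem_nhds hnot)
      ((hfin.subset sdiff_subset).isClosed.isOpen_compl.mem_nhds fun h => h.2 rfl)
  obtain ⟨y, hy, hyx⟩ := hKn.exists_ne x
  obtain ⟨w, hw, hwU, hwx, -⟩ := exists_mem_seg_near hyx.symm (eventually_seg_subset hU)
  have hKsub : seg x w ⊆ K :=
    (seg_subset_left hw).trans (seg_subset hKc.isPreconnected hx hy)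
  have hncrit : ∀ n, ∀ z ∈ seg x w, ¬ IsCriticalPoint f (f^[n + 1] z) := fun n z hz hc =>
    (hwU hz).1 (subset_closure ⟨⟨n + 1, by omega, hc⟩, hKsub hz⟩)
  refine not_iteratesInjOn_seg hf hwand hid hfib hfin hwx.symm fun n => ?_
  induction n with
  | zero => exact injOn_id _
  | succ n ih =>
    have him := image_seg (hf.iterate n) ih
    rw [iterate_succ']
    refine InjOn.comp ?_ ih (mapsTo_image _ _)
    rw [him]
    refine injOn_seg_of_not_critical hf ?_
    rw [← him]
    rintro _ ⟨z, hz, rfl⟩ hzx -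
    cases n with
    | zero => exact fun hc => (hwU hz).2 ⟨hc, hzx⟩
    | succ n => exact hncrit n z hz

theorem exists_fixed_mem_seg_of_unique_critical (hf : Continuous f) (hwand : NoWanderingContinua f)
    (hid : ¬ HasIdentityReturn f) {c : X} (hc : ∀ x, IsCriticalPoint f x → x = c)
    (hcne : f c ≠ c) : ∃ a ∈ seg c (f c), a ≠ c ∧ a ≠ f c ∧ f a = a := by
  have hinj : ∀ x, InjOn f (seg c x) := fun x => injOn_seg_of_not_critical hf
    fun z _ hzc _ hz => hzc (hc z hz)
  obtain ⟨a, ⟨haI, ha⟩, hmax⟩ := exists_maximal_of_chain_closed c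
    (S := {x | x ∈ seg c (f c) ∧ x ∈ seg c (f x)}) ⟨c, left_mem_seg _ _, left_mem_seg _ _⟩
    fun s hs _ e he1 _ he3 =>
      ⟨he3 _ fun x hx => (hs hx).1, sup_le_map hf (fun x hx => (hs hx).2) he1 he3⟩
  have hfix : f a = a := by
    by_contra hne
    -- If f a and f c lay in the same direction from a, then a could be pushed up inside `seg c (f
    -- c)`.
    have hamem : a ∈ seg (f c) (f a) := by
      by_contra hnot
      obtain ⟨v, hva, hv1, hv2⟩ := exists_common_of_notMem_seg hnot
      obtain ⟨y, hya, hyv, hay, hy, -⟩ := exists_push_up hf ha hv2 hva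
      exact hya (hmax y ⟨seg_subset_right haI (seg_subset_left hv1 hyv), hy⟩ hay)
    obtain ⟨y, hya, -, hay, hy, -⟩ := exists_push_up hf ha (right_mem_seg _ _) hne
    obtain ⟨b, hb, hyb⟩ := exists_fixed_above hf hy
    have hab : a ∈ seg c b := mem_seg_trans hyb hay
    have hne_ab : b ≠ a := by
      rintro rfl
      exact hya (seg_antisymm hyb hay)
    -- On `seg c b` the order is carried to the segment from f c to b, where a precedes f a; so f
    -- maps `seg b a` into itself.
    have hfa : f a ∈ seg b a := by
      have h1 := map_mem_seg hf (hinj b) hab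
      rw [hb] at h1
      rw [seg_comm]
      exact mem_seg_right h1 hamem
    have hiba : InjOn f (seg b a) := by
      rw [seg_comm]
      exact (hinj b).mono (seg_subset_right hab)
    refine not_periodic_endpoint hf hwand hid (iteratesInjOn_of_mapsTo hiba ?_) hne_ab one_pos hb
    intro z hz
    have := map_mem_seg hf hiba hz
    rw [hb] at this
    exact seg_subset_left hfa this
  refine ⟨a, haI, ?_, ?_, hfix⟩
  · rintro rfl
    exact hcne hfix
  · rintro rfl
    exact hcne (hinj (f c) (right_mem_seg _ _) (left_mem_seg _ _) hfix)

end CriticalPoints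

end DendriteMap

theorem mainTheorem7 {X : Type*} [TopologicalSpace X] [Nontrivial X]
    (hX : DendriteMap.IsDendrite X) (f : X → X) (hf : Continuous f)
    (hwand : DendriteMap.NoWanderingContinua f)
    (hid : ¬ DendriteMap.HasIdentityReturn f) :
    (∃ x : X, DendriteMap.IsCriticalPoint f x ∧ DendriteMap.IsCutpoint x ∧ f x ≠ x) ∧
    ((∀ y : X, (f ⁻¹' {y}).Finite) → {x : X | DendriteMap.IsCriticalPoint f x}.Finite →
      (∃ a : X, DendriteMap.IsCutpoint a ∧ f a = a) ∧
      (¬ ∃ I : Set X, DendriteMap.IsArc I ∧ ∀ n : ℕ, Set.InjOn f^[n] I) ∧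
      DendriteMap.IsCondense (DendriteMap.criticalPreimages f)) ∧
    (∀ c : X, (∀ x : X, DendriteMap.IsCriticalPoint f x ↔ x = c) →
      ∃ a ∈ DendriteMap.openArc c (f c), DendriteMap.IsCutpoint a ∧ f a = a) := by
  have : Fact (DendriteMap.IsDendrite X) := ⟨hX⟩
  have hcrit := DendriteMap.exists_critical_cutpoint_not_fixed hf hwand hid
  refine ⟨hcrit, fun hfib hfin => ⟨?_, ?_, ?_⟩, fun c hc => ?_⟩
  · obtain ⟨e, he, u, -, v, -, huv, hu, hv⟩ := DendriteMap.exists_fixed_between hf hwand hid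
      one_pos hfin isClosed_univ isPreconnected_univ Set.nontrivial_univ (Set.mapsTo_univ _ _)
    exact ⟨e, DendriteMap.isCutpoint_of_mem_seg huv hu hv, he⟩
  · rintro ⟨I, hI, hinj⟩
    obtain ⟨u, v, huv, rfl⟩ := hI.exists_eq_seg
    exact DendriteMap.not_iteratesInjOn_seg hf hwand hid hfib hfin huv hinj
  · exact DendriteMap.isCondense_criticalPreimages hf hwand hid hfib hfin
  -- Part 1 gives a non-fixed critical point, which must be c; hence f c ≠ c.
  · obtain ⟨x, hx, -, hxne⟩ := hcrit
    obtain rfl := (hc x).1 hx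
    obtain ⟨a, ha, hac, hafc, hfix⟩ := DendriteMap.exists_fixed_mem_seg_of_unique_critical hf hwand
      hid (fun y hy => (hc y).1 hy) hxne
    exact ⟨a, DendriteMap.mem_openArc ha hac hafc,
      DendriteMap.isCutpoint_of_mem_seg ha hac hafc, hfix⟩
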